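/- Let $\alpha\in(0,1]$ and let $f$ be analytic in the unit disk $\mathbb{D}=\{z\in\mathbb{C}:|z|<1\}$ with $f(0)=0$, $f'(0)=1$, and strongly starlike of order $\alpha$, i.e. $\left|\arg\frac{zf'(z)}{f(z)}\right|<\frac{\pi\alpha}{2}$ for $z\in\mathbb{D}$ (the quotient being defined and nonzero, with value $1$ at $z=0$). Let $f^{-1}$ be the inverse function of $f$ near the origin, and let the logarithmic inverse coefficients $\Gamma_n$ of $f$ be defined by $\log\frac{f^{-1}(w)}{w}=2\sum_{n=1}^{\infty}\Gamma_n w^n$ for $w$ near $0$ (with $\log 1=0$). Then $$|\Gamma_1\Gamma_3-\Gamma_2^2|\le\begin{cases}\dfrac{\alpha^2}{4}, & 0<\alpha<\frac15,\\[2mm] \dfrac{\alpha^2(2+5\alpha+15\alpha^2)}{7+30\alpha+35\alpha^2}, & \frac15\le\alpha\le\alpha',\\[2mm] \dfrac{\alpha^2}{36}(4+35\alpha^2), & \alpha'<\alpha\le 1,\end{cases}$$ where $\alpha'$ is the unique root in $(0,1)$ of the equation $44+60\alpha+155\alpha^2-1050\alpha^3-1225\alpha^4=0$; it satisfies $|\alpha'-0.390595|<10^{-6}$.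 The inequality is sharp: for every $\alpha\in(0,1]$ equality holds for some strongly starlike function of order $\alpha$. -/

import Mathlib

open Complex Metric Filter Topology

/-- The class `𝒜`: analytic functions on the open unit disk with `f 0 = 0` and `f' 0 = 1`. -/
structure IsNormalizedAnalytic (f : ℂ → ℂ) : Prop where
  differentiableOn : DifferentiableOn ℂ f (ball 0 1)
  map_zero : f 0 = 0
  deriv_zero : deriv f 0 = 1

/-- `f ∈ 𝒜` is strongly starlike of order `α` if `|arg (z f'(z) / f(z))| < π α / 2` in the unit disk.
For this to make sense the quotient has to be defined and nonzero, which is required explicitly;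
at `z = 0` the quotient has the removable value `1`, so that nothing is demanded there. -/
structure IsStronglyStarlike (α : ℝ) (f : ℂ → ℂ) : Prop extends IsNormalizedAnalytic f where
  ne_zero : ∀ z ∈ ball (0 : ℂ) 1, z ≠ 0 → f z ≠ 0
  deriv_ne_zero : ∀ z ∈ ball (0 : ℂ) 1, z ≠ 0 → deriv f z ≠ 0
  abs_arg_lt : ∀ z ∈ ball (0 : ℂ) 1, z ≠ 0 → |arg (z * deriv f z / f z)| < Real.pi * α / 2

open Classical in
/-- The inverse function `f⁻¹` of `f`, defined near the origin (for `f` analytic at `0` with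
`f 0 = 0` and `f' 0 ≠ 0`; it is the local inverse given by the inverse function theorem). -/
noncomputable def inverseNearZero (f : ℂ → ℂ) : ℂ → ℂ :=
  if h : AnalyticAt ℂ f 0 ∧ deriv f 0 ≠ 0 then
    h.1.hasStrictDerivAt.localInverse f (deriv f 0) 0 h.2
  else 0

/-- `F_g(w) = log (g(w) / w)`, with the removable value `log (g' 0)` at `w = 0`. -/
noncomputable def logQuotient (g : ℂ → ℂ) (w : ℂ) : ℂ := log (dslope g 0 w)

/-- The logarithmic coefficients of `g`: half the Taylor coefficients of `F_g` at `0`, so that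
`log (g(w) / w) = 2 ∑ n, (logCoeff g n) w ^ n`. -/
noncomputable def logCoeff (g : ℂ → ℂ) (n : ℕ) : ℂ :=
  iteratedDeriv n (logQuotient g) 0 / (n.factorial : ℂ) / 2

/-- The logarithmic inverse coefficients `Γ_n` of `f`: the logarithmic coefficients of `f⁻¹`. -/
noncomputable def logInvCoeff (f : ℂ → ℂ) (n : ℕ) : ℂ := logCoeff (inverseNearZero f) n

/-! The following facts show that these objects are the intended ones for every `f ∈ 𝒜`. -/

theorem IsNormalizedAnalytic.inverseNearZero_spec {f : ℂ → ℂ} (hf : IsNormalizedAnalytic f) :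
    AnalyticAt ℂ (inverseNearZero f) 0 ∧ inverseNearZero f 0 = 0 ∧
      (∀ᶠ w in 𝓝 (0 : ℂ), f (inverseNearZero f w) = w) ∧
      (∀ᶠ z in 𝓝 (0 : ℂ), inverseNearZero f (f z) = z) := by
  have ha : AnalyticAt ℂ f 0 := hf.differentiableOn.analyticAt (ball_mem_nhds 0 one_pos)
  have hd : deriv f 0 ≠ 0 := by rw [hf.deriv_zero]; exact one_ne_zero
  have he : inverseNearZero f = ha.hasStrictDerivAt.localInverse f (deriv f 0) 0 hd := by
    unfold inverseNearZero
    rw [dif_pos ⟨ha, hd⟩]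
  have h1 := ha.analyticAt_localInverse hd
  have h2 := ha.hasStrictDerivAt.eventually_right_inverse hd
  have h3 := ha.hasStrictDerivAt.eventually_left_inverse hd
  rw [← he] at h1 h2 h3
  rw [hf.map_zero] at h1 h2
  refine ⟨h1, ?_, h2, h3⟩
  have := h3.self_of_nhds
  rwa [hf.map_zero] at this

theorem IsNormalizedAnalytic.hasSum_logInvCoeff {f : ℂ → ℂ} (hf : IsNormalizedAnalytic f) :
    logInvCoeff f 0 = 0 ∧ ∀ᶠ w in 𝓝[≠] (0 : ℂ),
      HasSum (fun n : ℕ => 2 * logInvCoeff f n * w ^ n) (log (inverseNearZero f w / w)) := by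
  obtain ⟨ha, h0, hr, -⟩ := hf.inverseNearZero_spec
  have hg : deriv (inverseNearZero f) 0 = 1 := by
    have hfd : HasDerivAt f 1 (inverseNearZero f 0) := by
      have : AnalyticAt ℂ f 0 := hf.differentiableOn.analyticAt (ball_mem_nhds 0 one_pos)
      rw [h0, ← hf.deriv_zero]
      exact this.differentiableAt.hasDerivAt
    have hc := hfd.comp (0 : ℂ) ha.differentiableAt.hasDerivAt
    have hid : HasDerivAt (f ∘ inverseNearZero f) 1 0 :=
      (hasDerivAt_id (0 : ℂ)).congr_of_eventuallyEq hr
    simpa using hc.unique hid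
  have hds : AnalyticAt ℂ (dslope (inverseNearZero f) 0) 0 := by
    obtain ⟨p, hp⟩ := ha
    exact hp.has_fpower_series_dslope_fslope.analyticAt
  have hF : AnalyticAt ℂ (logQuotient (inverseNearZero f)) 0 := by
    refine AnalyticAt.clog hds ?_
    rw [dslope_same, hg]
    exact one_mem_slitPlane
  refine ⟨by simp [logInvCoeff, logCoeff, logQuotient, hg], ?_⟩
  have hs := (hasFPowerSeriesAt_iff.1 hF.hasFPowerSeriesAt)
  filter_upwards [hs.filter_mono nhdsWithin_le_nhds, self_mem_nhdsWithin] with w hw hw0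
  have hval : logQuotient (inverseNearZero f) (0 + w) = log (inverseNearZero f w / w) := by
    rw [zero_add, logQuotient, dslope_of_ne _ hw0, slope_def_field, h0, sub_zero, sub_zero]
  rw [hval] at hw
  have hfun : (fun n : ℕ => 2 * logInvCoeff f n * w ^ n) = fun n : ℕ => w ^ n •
      (FormalMultilinearSeries.ofScalars ℂ fun n : ℕ =>
        iteratedDeriv n (logQuotient (inverseNearZero f)) 0 / (n.factorial : ℂ)).coeff n := by
    funext n
    rw [FormalMultilinearSeries.coeff_ofScalars, logInvCoeff, logCoeff, smul_eq_mul]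
    ring
  rw [hfun]
  exact hw

/-! Write `z f'/f = ((1+ω)/(1-ω))^α` with a Schwarz function `ω = c₁z + c₂z² + c₃z³ + ⋯`. Comparing
Taylor coefficients through `f⁻¹` and the logarithm expresses the determinant by `c₁, c₂, c₃`
(`hankel_logInvCoeff`), and the Schur parameters `c₁, x, y` of `ω` (`exists_schur_parameters`)
describe the coefficients that can occur.

Put `s = |c₁|²`, `ρ = |x|`, `D = (35α²+4)/9`. Up to the factor `α²/4`, the determinant is a
trinomial in `c₁²` and `x` plus a term in `y` of size at most `κ(1-ρ²)`. The squared modulus of the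
trinomial is a concave quadratic in the cosine `u` of the angle between `c₁²` and `x`. Maximizing
over `u` and `ρ` leaves three candidates (`le_of_critical_bounds`): an endpoint `u = 1` with `ρ =
1`, an endpoint maximized over `ρ`, and the vertex with `ρ = 1`.

The first candidate is `Q(s) = 1 + s(10α-2)/3 - s²(35α²+30α+7)/9`; `|Q(s)|` is attained by `ω =
z(c+z)/(1+cz)` with `c = √s`. The other two never exceed the larger of `D = |Q(1)|` and the maximum
of `Q` on `[0,1]` (`third_critical_bound`, `second_critical_bound`). Hence that larger number is the
sharp constant. The three regimes are: `Q` maximal at `0`, `Q` maximal at an interior point, and `D`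
dominating; the quartic marks the change between the last two. -/

/-! ### Third-order jets at the origin. -/

/-- `F z = a + b z + c z² + d z³ + O(z⁴)` as `z → 0`. -/
def HasJet (F : ℂ → ℂ) (a b c d : ℂ) : Prop :=
  (fun z => F z - (a + b * z + c * z ^ 2 + d * z ^ 3)) =O[𝓝 0] fun z : ℂ => z ^ 4

namespace HasJet

variable {F G : ℂ → ℂ} {a b c d a' b' c' d' : ℂ}

theorem congr (h : HasJet F a b c d) (hFG : F =ᶠ[𝓝 0] G) : HasJet G a b c d :=
  Asymptotics.IsBigO.congr' h (hFG.mono fun z hz => by simp only [hz]) EventuallyEq.rfl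

theorem poly (a b c d : ℂ) : HasJet (fun z => a + b * z + c * z ^ 2 + d * z ^ 3) a b c d := by
  simpa [HasJet] using Asymptotics.isBigO_zero _ _

theorem id : HasJet (fun z => z) 0 1 0 0 := by simpa using poly 0 1 0 0

theorem const (a : ℂ) : HasJet (fun _ => a) a 0 0 0 := by simpa using poly a 0 0 0

theorem add (h : HasJet F a b c d) (h' : HasJet G a' b' c' d') :
    HasJet (fun z => F z + G z) (a + a') (b + b') (c + c') (d + d') :=
  (Asymptotics.IsBigO.add h h').congr_left fun z => by ring

theorem neg (h : HasJet F a b c d) : HasJet (fun z => -F z) (-a) (-b) (-c) (-d) :=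
  (Asymptotics.IsBigO.neg_left h).congr_left fun z => by ring

theorem isBigO_one (h : HasJet F a b c d) : F =O[𝓝 0] fun _ => (1 : ℂ) := by
  have h1 : (fun z : ℂ => z ^ 4) =O[𝓝 0] fun _ => (1 : ℂ) :=
    (by fun_prop : ContinuousAt (fun z : ℂ => z ^ 4) 0).tendsto.isBigO_one ℂ
  have h2 : (fun z : ℂ => a + b * z + c * z ^ 2 + d * z ^ 3) =O[𝓝 0] fun _ => (1 : ℂ) :=
    (by fun_prop : ContinuousAt (fun z : ℂ => a + b * z + c * z ^ 2 + d * z ^ 3) 0).tendsto.isBigO_one ℂ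
  simpa using (Asymptotics.IsBigO.trans h h1).add h2

theorem mul (h : HasJet F a b c d) (h' : HasJet G a' b' c' d') :
    HasJet (fun z => F z * G z) (a * a') (a * b' + b * a') (a * c' + b * b' + c * a')
      (a * d' + b * c' + c * b' + d * a') := by
  have h1 := (Asymptotics.IsBigO.mul h h'.isBigO_one)
  have h2 := ((poly a b c d).isBigO_one).mul h'
  have h3 : (fun z : ℂ => z ^ 4 * (b * d' + c * c' + d * b' + (c * d' + d * c') * z +
      d * d' * z ^ 2)) =O[𝓝 0] fun z : ℂ => z ^ 4 * 1 :=
    (Asymptotics.isBigO_refl _ _).mul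
      ((by fun_prop : ContinuousAt (fun z : ℂ => b * d' + c * c' + d * b' + (c * d' + d * c') * z +
        d * d' * z ^ 2) 0).tendsto.isBigO_one ℂ)
  simp only [mul_one, one_mul] at h1 h2 h3
  exact ((h1.add h2).add h3).congr_left fun z => by ring

theorem comp (h : HasJet F a b c d) (h' : HasJet G 0 b' c' d') :
    HasJet (fun z => F (G z)) a (b * b') (b * c' + c * b' ^ 2)
      (b * d' + 2 * c * b' * c' + d * b' ^ 3) := by
  -- The vanishing constant term of `G` makes `O(G⁴)` an `O(z⁴)` error.
  have hO : G =O[𝓝 0] fun z : ℂ => z := by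
    have h1 : (fun z : ℂ => z * z ^ 3) =O[𝓝 0] fun z : ℂ => z * 1 :=
      (Asymptotics.isBigO_refl _ _).mul
        ((by fun_prop : ContinuousAt (fun z : ℂ => z ^ 3) 0).tendsto.isBigO_one ℂ)
    have h2 : (fun z : ℂ => z * (b' + c' * z + d' * z ^ 2)) =O[𝓝 0] fun z : ℂ => z * 1 :=
      (Asymptotics.isBigO_refl _ _).mul
        ((by fun_prop : ContinuousAt (fun z : ℂ => b' + c' * z + d' * z ^ 2) 0).tendsto.isBigO_one ℂ)
    have h3 := Asymptotics.IsBigO.trans (h'.congr_right fun z => (by ring : z ^ 4 = z * z ^ 3)) h1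
    simp only [mul_one] at h2 h3
    exact (h3.add h2).congr_left fun z => by ring
  have ht : Tendsto G (𝓝 0) (𝓝 0) := hO.trans_tendsto tendsto_id
  have h1 := Asymptotics.IsBigO.trans (Asymptotics.IsBigO.comp_tendsto h ht) (hO.pow 4)
  have h2 := (((const a).add ((const b).mul h')).add ((const c).mul (h'.mul h'))).add
    ((const d).mul ((h'.mul h').mul h'))
  refine (h1.add h2).congr_left fun z => ?_
  simp only [Function.comp]
  ring

/-- Coefficients are peeled off one by one: once the lower ones vanish, the polynomial is `z^k g(z)`
with `g` continuous, and `O(z^(k+1))` forces `g 0 = 0`. -/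
theorem eq_of_const_zero {a b c d : ℂ} (h : HasJet (fun _ => 0) a b c d) :
    a = 0 ∧ b = 0 ∧ c = 0 ∧ d = 0 := by
  have key : ∀ {g : ℂ → ℂ} (k : ℕ), ContinuousAt g 0 →
      (fun z : ℂ => z ^ k * g z) =O[𝓝 0] (fun z : ℂ => z ^ (k + 1)) → g 0 = 0 := by
    intro g k hg hO
    have h1 : (fun z : ℂ => z ^ k * g z) =O[𝓝[≠] 0] (fun z : ℂ => z ^ k * z) :=
      hO.mono nhdsWithin_le_nhds
    have h2 : g =O[𝓝[≠] 0] (fun z : ℂ => z) := by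
      obtain ⟨C, hC⟩ := h1.bound
      refine Asymptotics.IsBigO.of_bound C ?_
      filter_upwards [hC, self_mem_nhdsWithin] with z hz hz0
      rw [norm_mul, norm_mul, mul_left_comm] at hz
      exact le_of_mul_le_mul_left hz (norm_pos_iff.2 (pow_ne_zero _ hz0))
    have h3 : Tendsto g (𝓝[≠] 0) (𝓝 0) :=
      h2.trans_tendsto (tendsto_id.mono_left nhdsWithin_le_nhds)
    exact tendsto_nhds_unique (hg.tendsto.mono_left nhdsWithin_le_nhds) h3
  have lower : ∀ {k : ℕ}, k ≤ 4 → (fun z : ℂ => z ^ 4) =O[𝓝 0] (fun z : ℂ => z ^ k) :=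
    fun hk => Asymptotics.IsBigO.of_bound 1 (by
      filter_upwards [ball_mem_nhds (0 : ℂ) one_pos] with z hz
      rw [norm_pow, norm_pow, one_mul]
      exact pow_le_pow_of_le_one (norm_nonneg z) (mem_ball_zero_iff.1 hz).le hk)
  have h0 : (fun z : ℂ => a + b * z + c * z ^ 2 + d * z ^ 3) =O[𝓝 0] fun z : ℂ => z ^ 4 :=
    (Asymptotics.IsBigO.neg_left h).congr_left fun z => by ring
  have ha := key (g := fun z => a + b * z + c * z ^ 2 + d * z ^ 3) 0 (by fun_prop)
    ((h0.trans (lower (by norm_num))).congr_left fun z => by ring)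
  simp at ha
  subst ha
  have hb := key (g := fun z => b + c * z + d * z ^ 2) 1 (by fun_prop)
    ((h0.trans (lower (by norm_num))).congr_left fun z => by ring)
  simp at hb
  subst hb
  have hc := key (g := fun z => c + d * z) 2 (by fun_prop)
    ((h0.trans (lower (by norm_num))).congr_left fun z => by ring)
  simp at hc
  subst hc
  have hd := key (g := fun z => d) 3 (by fun_prop)
    ((h0.trans (lower (by norm_num))).congr_left fun z => by ring)
  exact ⟨rfl, rfl, rfl, hd⟩

theorem unique (h : HasJet F a b c d) (h' : HasJet F a' b' c' d') :
    a = a' ∧ b = b' ∧ c = c' ∧ d = d' := by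
  have := (h.add h'.neg).congr (G := fun _ => 0) (Eventually.of_forall fun z => by simp)
  obtain ⟨h1, h2, h3, h4⟩ := eq_of_const_zero this
  exact ⟨sub_eq_zero.1 (by linear_combination h1), sub_eq_zero.1 (by linear_combination h2),
    sub_eq_zero.1 (by linear_combination h3), sub_eq_zero.1 (by linear_combination h4)⟩

theorem unique_of_eventuallyEq (h : HasJet F a b c d) (h' : HasJet G a' b' c' d')
    (hFG : F =ᶠ[𝓝 0] G) : a = a' ∧ b = b' ∧ c = c' ∧ d = d' :=
  (h.congr hFG).unique h'

end HasJet

theorem AnalyticAt.hasJet {F : ℂ → ℂ} (hF : AnalyticAt ℂ F 0) :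
    HasJet F (F 0) (deriv F 0) (iteratedDeriv 2 F 0 / 2) (iteratedDeriv 3 F 0 / 6) := by
  have h := hF.hasFPowerSeriesAt.isBigO_sub_partialSum_pow 4
  refine (h.trans (?_ : _ =O[𝓝 0] fun z : ℂ => z ^ 4)).congr_left fun z => ?_
  · exact Asymptotics.IsBigO.of_bound 1 (Eventually.of_forall fun z => by simp)
  · simp only [FormalMultilinearSeries.partialSum, Finset.sum_range_succ, Finset.sum_range_zero,
      FormalMultilinearSeries.apply_eq_pow_smul_coeff, FormalMultilinearSeries.coeff_ofScalars]
    simp [Nat.factorial, iteratedDeriv_one]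
    ring

/-- The last coefficient `e` comes from the fourth-order term of `F`, which the jet does not record.
-/
theorem HasJet.deriv {F : ℂ → ℂ} {a b c d : ℂ} (hF : AnalyticAt ℂ F 0) (h : HasJet F a b c d) :
    ∃ e, HasJet (deriv F) b (2 * c) (3 * d) e := by
  obtain ⟨-, rfl, rfl, rfl⟩ := h.unique hF.hasJet
  have h' := hF.deriv.hasJet
  refine ⟨iteratedDeriv 3 (_root_.deriv F) 0 / 6, ?_⟩
  convert h' using 1
  · rw [iteratedDeriv_succ', iteratedDeriv_one]; ring
  · rw [iteratedDeriv_succ' (n := 2)]; ring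

/-! ### Schur parameters of a Schwarz function. -/

section Schur

open ComplexConjugate

/-- The difference of the squares is `(1-|a|²)(1-|b|²)`. -/
theorem norm_sub_le_norm_one_sub_conj_mul {a b : ℂ} (ha : ‖a‖ ≤ 1) (hb : ‖b‖ ≤ 1) :
    ‖b - a‖ ≤ ‖1 - conj a * b‖ := by
  refine le_of_sq_le_sq ?_ (norm_nonneg _)
  have h1 : normSq a ≤ 1 := by rw [normSq_eq_norm_sq]; nlinarith [norm_nonneg a]
  have h2 : normSq b ≤ 1 := by rw [normSq_eq_norm_sq]; nlinarith [norm_nonneg b]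
  rw [← normSq_eq_norm_sq, ← normSq_eq_norm_sq]
  rw [normSq_apply] at h1 h2 ⊢
  rw [normSq_apply]
  simp
  nlinarith [mul_nonneg (sub_nonneg.2 h1) (sub_nonneg.2 h2)]

theorem dslope_zero_mul {ψ : ℂ → ℂ} (h : ψ 0 = 0) (z : ℂ) : z * dslope ψ 0 z = ψ z := by
  simpa [h] using sub_smul_dslope ψ 0 z

/-- One step of the Schur algorithm for a bounded analytic function. -/
theorem exists_schur_transform {ψ : ℂ → ℂ} (hd : DifferentiableOn ℂ ψ (ball 0 1))
    (hb : ∀ z ∈ ball (0 : ℂ) 1, ‖ψ z‖ ≤ 1) :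
    ∃ χ : ℂ → ℂ, DifferentiableOn ℂ χ (ball 0 1) ∧ (∀ z ∈ ball (0 : ℂ) 1, ‖χ z‖ ≤ 1) ∧
      ∀ z ∈ ball (0 : ℂ) 1, ψ z * (1 + conj (ψ 0) * (z * χ z)) = ψ 0 + z * χ z := by
  have h0 : (0 : ℂ) ∈ ball (0 : ℂ) 1 := mem_ball_self one_pos
  rcases (hb 0 h0).eq_or_lt with h | h
  -- If `|ψ 0| = 1`, the maximum principle makes `ψ` constant, and `χ = 0` satisfies the relation,
  -- which is stated without division for this reason.
  · refine ⟨0, differentiableOn_const 0, by simp, fun z hz => ?_⟩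
    have : ψ z = ψ 0 := Complex.eqOn_of_isPreconnected_of_isMaxOn_norm
      (convex_ball (0 : ℂ) 1).isPreconnected isOpen_ball hd h0
      (fun w hw => by simpa [h] using hb w hw) hz
    simp [this]
  have hden : ∀ z ∈ ball (0 : ℂ) 1, 1 - conj (ψ 0) * ψ z ≠ 0 := by
    intro z hz he
    have h1 : ‖conj (ψ 0) * ψ z‖ = 1 := by rw [← sub_eq_zero.1 he, norm_one]
    rw [norm_mul, norm_conj] at h1
    nlinarith [norm_nonneg (ψ 0), norm_nonneg (ψ z), hb z hz]
  set m : ℂ → ℂ := fun z => (ψ z - ψ 0) / (1 - conj (ψ 0) * ψ z) with hm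
  have hmd : DifferentiableOn ℂ m (ball 0 1) :=
    (hd.sub_const _).div ((hd.const_mul _).const_sub _) hden
  have hm0 : m 0 = 0 := by simp [hm]
  have hmb : ∀ z ∈ ball (0 : ℂ) 1, ‖m z‖ ≤ 1 := by
    intro z hz
    rw [hm, norm_div]
    exact div_le_one_of_le₀ (norm_sub_le_norm_one_sub_conj_mul h.le (hb z hz)) (norm_nonneg _)
  refine ⟨dslope m 0, (Complex.differentiableOn_dslope (ball_mem_nhds 0 one_pos)).2 hmd,
    fun z hz => ?_, fun z hz => ?_⟩
  · simpa using Complex.norm_dslope_le_div_of_mapsTo_ball (R₂ := 1) hmd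
      (fun w hw => by simpa [hm0] using hmb w hw) hz
  · rw [dslope_zero_mul hm0]
    have : m z * (1 - conj (ψ 0) * ψ z) = ψ z - ψ 0 := div_mul_cancel₀ _ (hden z hz)
    linear_combination -this

theorem schur_transform_coeff {ψ χ : ℂ → ℂ} (hψ : DifferentiableOn ℂ ψ (ball 0 1))
    (h : ∀ z ∈ ball (0 : ℂ) 1, ψ z * (1 + conj (ψ 0) * (z * χ z)) = ψ 0 + z * χ z)
    {a b c d a' b' c' d' : ℂ} (hj : HasJet ψ a b c d) (hj' : HasJet χ a' b' c' d') :
    b = (1 - ‖a‖ ^ 2) * a' ∧ c = (1 - ‖a‖ ^ 2) * b' - conj a * a' * b := by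
  have ha : a = ψ 0 :=
    (hj.unique (hψ.analyticAt (ball_mem_nhds 0 one_pos)).hasJet).1
  have hz := HasJet.id.mul hj'
  obtain ⟨-, h1, h2, -⟩ := (hj.mul ((HasJet.const 1).add
    ((HasJet.const (conj (ψ 0))).mul hz))).unique_of_eventuallyEq ((HasJet.const (ψ 0)).add hz)
    (by filter_upwards [ball_mem_nhds (0 : ℂ) one_pos] with z hz using h z hz)
  rw [← ha] at h1 h2
  have hcc : a * conj a = (‖a‖ : ℂ) ^ 2 := by rw [mul_conj, normSq_eq_norm_sq]; simp
  constructor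
  · linear_combination h1 - a' * hcc
  · linear_combination h2 - b' * hcc

/-- The first three coefficients of a Schwarz function in terms of its Schur parameters. -/
theorem exists_schur_parameters {ω : ℂ → ℂ} (hd : DifferentiableOn ℂ ω (ball 0 1))
    (hb : ∀ z ∈ ball (0 : ℂ) 1, ‖ω z‖ ≤ 1) (h0 : ω 0 = 0) {c₀ c₁ c₂ c₃ : ℂ}
    (hj : HasJet ω c₀ c₁ c₂ c₃) :
    ∃ x y : ℂ, ‖c₁‖ ≤ 1 ∧ ‖x‖ ≤ 1 ∧ ‖y‖ ≤ 1 ∧ c₂ = (1 - ‖c₁‖ ^ 2) * x ∧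
      c₃ = (1 - ‖c₁‖ ^ 2) * ((1 - ‖x‖ ^ 2) * y - conj c₁ * x ^ 2) := by
  have hz : (0 : ℂ) ∈ ball (0 : ℂ) 1 := mem_ball_self one_pos
  have hn : ball (0 : ℂ) 1 ∈ 𝓝 0 := ball_mem_nhds 0 one_pos
  -- By the Schwarz lemma `ω(z)/z` is again bounded by 1; two Schur steps from it yield `x = χ 0`
  -- and `y = ξ 0`.
  set ψ := dslope ω 0 with hψ
  have hψd : DifferentiableOn ℂ ψ (ball 0 1) := (Complex.differentiableOn_dslope hn).2 hd
  have hψb : ∀ z ∈ ball (0 : ℂ) 1, ‖ψ z‖ ≤ 1 := fun z hz => by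
    simpa using Complex.norm_dslope_le_div_of_mapsTo_ball (R₂ := 1) hd
      (fun w hw => by simpa [h0] using hb w hw) hz
  obtain ⟨χ, hχd, hχb, hχ⟩ := exists_schur_transform hψd hψb
  obtain ⟨ξ, hξd, hξb, hξ⟩ := exists_schur_transform hχd hχb
  have jψ := (hψd.analyticAt hn).hasJet
  have jχ := (hχd.analyticAt hn).hasJet
  have jξ := (hξd.analyticAt hn).hasJet
  obtain ⟨-, e1, e2, e3⟩ := hj.unique_of_eventuallyEq (HasJet.id.mul jψ)
    (Eventually.of_forall fun z => (dslope_zero_mul h0 z).symm)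
  obtain ⟨p1, p2⟩ := schur_transform_coeff hψd hχ jψ jχ
  obtain ⟨q1, -⟩ := schur_transform_coeff hχd hξ jχ jξ
  simp only [zero_mul, one_mul, add_zero, zero_add] at e1 e2 e3
  rw [p1] at p2 e2
  rw [q1] at p2
  refine ⟨χ 0, ξ 0, e1 ▸ hψb 0 hz, hχb 0 hz, hξb 0 hz, ?_, ?_⟩
  · rw [e1, e2]
  · rw [e1, e3, p2]; ring

end Schur

/-! ### Logarithmic inverse coefficients in terms of the Schwarz function. -/

theorem logCoeff_of_hasJet {g : ℂ → ℂ} (hg : AnalyticAt ℂ (logQuotient g) 0) {a b c d : ℂ}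
    (h : HasJet (logQuotient g) a b c d) :
    logCoeff g 1 = b / 2 ∧ logCoeff g 2 = c / 2 ∧ logCoeff g 3 = d / 2 := by
  obtain ⟨-, rfl, rfl, rfl⟩ := h.unique hg.hasJet
  simp [logCoeff, iteratedDeriv_one, Nat.factorial]

/-- The Hankel determinant of the logarithmic inverse coefficients in terms of the coefficients of
the Schwarz function `ω` for which `z f' / f = ((1 + ω) / (1 - ω)) ^ α`. -/
theorem hankel_logInvCoeff {f g ω : ℂ → ℂ} {α c₁ c₂ c₃ : ℂ} (hf : IsNormalizedAnalytic f)
    (hg : AnalyticAt ℂ g 0) (hg0 : g 0 = 1) (hω : AnalyticAt ℂ ω 0)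
    (hfg : ∀ᶠ z in 𝓝 0, z * deriv f z = f z * g z)
    (hgω : ∀ᶠ z in 𝓝 0, deriv g z * (1 - ω z ^ 2) = 2 * α * deriv ω z * g z)
    (hj : HasJet ω 0 c₁ c₂ c₃) :
    logInvCoeff f 1 * logInvCoeff f 3 - logInvCoeff f 2 ^ 2 = α ^ 2 / 4 *
      (4 / 3 * c₁ * c₃ - c₂ ^ 2 - 10 / 3 * α * c₁ ^ 2 * c₂ + (35 * α ^ 2 + 4) / 9 * c₁ ^ 4) := by
  obtain ⟨hφ, hφ0, hr, -⟩ := hf.inverseNearZero_spec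
  set φ := inverseNearZero f with hφdef
  have hfa : AnalyticAt ℂ f 0 := hf.differentiableOn.analyticAt (ball_mem_nhds 0 one_pos)
  have hE : AnalyticAt ℂ (dslope φ 0) 0 := by
    obtain ⟨p, hp⟩ := hφ
    exact hp.has_fpower_series_dslope_fslope.analyticAt
  set E := dslope φ 0 with hEdef
  have hφE : ∀ w, w * E w = φ w := dslope_zero_mul hφ0
  have jf := hfa.hasJet
  rw [hf.map_zero, hf.deriv_zero] at jf
  obtain ⟨e₀, e₁, e₂, e₃, jE⟩ : ∃ e₀ e₁ e₂ e₃, HasJet E e₀ e₁ e₂ e₃ := ⟨_, _, _, _, hE.hasJet⟩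
  have jφ : HasJet φ 0 e₀ e₁ e₂ := by
    have := (HasJet.id.mul jE).congr (Eventually.of_forall hφE)
    simpa using this
  obtain ⟨-, he₀, -, -⟩ := (jf.comp jφ).unique_of_eventuallyEq HasJet.id hr
  rw [one_mul] at he₀
  subst he₀
  have hE0 : E 0 = 1 := (hE.hasJet.unique jE).1
  have hslit : E 0 ∈ slitPlane := by rw [hE0]; exact one_mem_slitPlane
  have hL : AnalyticAt ℂ (logQuotient φ) 0 := hE.clog hslit
  obtain ⟨l₁, l₂, l₃, jL⟩ : ∃ l₁ l₂ l₃, HasJet (logQuotient φ) 0 l₁ l₂ l₃ := by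
    have := hL.hasJet
    rw [show logQuotient φ 0 = 0 by rw [logQuotient, ← hEdef, hE0, log_one]] at this
    exact ⟨_, _, _, this⟩
  obtain ⟨g1, g2, g3⟩ := logCoeff_of_hasJet hL jL
  rw [logInvCoeff, logInvCoeff, logInvCoeff, ← hφdef, g1, g2, g3]
  -- Differentiating `log E` turns the logarithm into a relation between jets of products.
  have hLE : ∀ᶠ w in 𝓝 0, deriv E w = deriv (logQuotient φ) w * E w := by
    filter_upwards [hE.eventually_analyticAt,
      hE.continuousAt.eventually (isOpen_slitPlane.mem_nhds hslit)] with w hw hw'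
    have : HasDerivAt (logQuotient φ) (deriv E w / E w) w :=
      hw.differentiableAt.hasDerivAt.clog hw'
    rw [this.deriv, div_mul_cancel₀ _ (slitPlane_ne_zero hw')]
  obtain ⟨_, jL'⟩ := HasJet.deriv hL jL
  obtain ⟨_, jE'⟩ := HasJet.deriv hE jE
  obtain ⟨r1, r2, r3, -⟩ := jE'.unique_of_eventuallyEq (jL'.mul jE) hLE
  -- Put `z = φ w` in `z f' = f g`: since `f(φ w) = w` and `f'(φ) φ' = 1`, this gives `φ = w g(φ)
  -- φ'`, where `φ = w E`.
  have hgE : ∀ᶠ w in 𝓝 0, E w = g (φ w) * (E w + w * deriv E w) := by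
    have ht : Tendsto φ (𝓝 0) (𝓝 0) := by simpa [hφ0] using hφ.continuousAt.tendsto
    filter_upwards [hE.eventually_analyticAt, hr.eventually_nhds, hr, ht.eventually hfg,
      ht.eventually hfa.eventually_analyticAt] with w h1 h2 h3 h4 h5
    rcases eq_or_ne w 0 with rfl | hw
    · simp [hφ0, hg0]
    have hφ' : HasDerivAt φ (E w + w * deriv E w) w := by
      have := (hasDerivAt_id w).mul h1.differentiableAt.hasDerivAt
      simp only [_root_.id, one_mul] at this
      exact this.congr_of_eventuallyEq (Eventually.of_forall fun v => (hφE v).symm)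
    have hc := h5.differentiableAt.hasDerivAt.comp w hφ'
    have h6 := hc.unique ((hasDerivAt_id w).congr_of_eventuallyEq h2)
    refine mul_left_cancel₀ hw ?_
    rw [h3] at h4
    rw [hφE]
    linear_combination (-φ w) * h6 + (E w + w * deriv E w) * h4
  have jg := hg.hasJet
  rw [hg0] at jg
  obtain ⟨b₁, b₂, b₃, jg⟩ : ∃ b₁ b₂ b₃, HasJet g 1 b₁ b₂ b₃ := ⟨_, _, _, jg⟩
  obtain ⟨-, s1, s2, s3⟩ := jE.unique_of_eventuallyEq
    ((jg.comp jφ).mul (jE.add (HasJet.id.mul jE'))) hgE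
  obtain ⟨_, jg'⟩ := HasJet.deriv hg jg
  obtain ⟨_, jω'⟩ := HasJet.deriv hω hj
  obtain ⟨t1, t2, t3, -⟩ := (jg'.mul ((HasJet.const 1).add (hj.mul hj).neg)).unique_of_eventuallyEq
    (((HasJet.const (2 * α)).mul jω').mul jg)
    (hgω.mono fun z hz => by linear_combination hz)
  have hb₁ : b₁ = 2 * α * c₁ := by linear_combination t1
  subst hb₁
  have hb₂ : b₂ = 2 * α * c₂ + 2 * α ^ 2 * c₁ ^ 2 := by linear_combination t2 / 2
  subst hb₂
  have hb₃ : b₃ = 2 * α * c₃ + 4 * α ^ 2 * c₁ * c₂ + (4 * α ^ 3 / 3 + 2 * α / 3) * c₁ ^ 3 := by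
    linear_combination t3 / 3
  subst hb₃
  have hl₁ : l₁ = e₁ := by linear_combination -r1
  subst hl₁
  have he₁ : l₁ = -(2 * α * c₁) := by linear_combination -s1
  subst he₁
  have he₂ : e₂ = l₂ + 2 * α ^ 2 * c₁ ^ 2 := by linear_combination r2 / 2
  subst he₂
  have hl₂ : l₂ = 4 * α ^ 2 * c₁ ^ 2 - α * c₂ - α ^ 2 * c₁ ^ 2 := by
    linear_combination -s2 / 2
  subst hl₂
  have he₃ : 3 * e₃ = 3 * l₃ - 6 * α * c₁ * (3 * α ^ 2 * c₁ ^ 2 - α * c₂) -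
      4 * α ^ 3 * c₁ ^ 3 := by
    linear_combination r3
  linear_combination (α * c₁ / 6) * s3 + (α * c₁ / 6) * he₃

/-! ### Strongly starlike functions and Schwarz functions. -/

theorem re_pos_iff_norm_lt {P : ℂ} : 0 < P.re ↔ ‖P - 1‖ < ‖P + 1‖ := by
  rw [← sq_lt_sq₀ (norm_nonneg _) (norm_nonneg _), ← normSq_eq_norm_sq, ← normSq_eq_norm_sq,
    normSq_apply, normSq_apply]
  simp
  constructor <;> intro h <;> nlinarith

theorem cayley_re_pos {w : ℂ} (hw : ‖w‖ < 1) : 0 < ((1 + w) / (1 - w)).re := by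
  have h1 : 1 - w ≠ 0 := by
    intro h
    rw [← sub_eq_zero.1 h, norm_one] at hw
    exact lt_irrefl _ hw
  have h2 : (1 + w) / (1 - w) - 1 = w * (2 / (1 - w)) := by field_simp; ring
  have h3 : (1 + w) / (1 - w) + 1 = 1 * (2 / (1 - w)) := by field_simp; ring
  rw [re_pos_iff_norm_lt, h2, h3, norm_mul, norm_mul, norm_one]
  exact mul_lt_mul_of_pos_right hw (by simpa using h1)

theorem arg_exp_of_mem {w : ℂ} (h1 : -Real.pi < w.im) (h2 : w.im ≤ Real.pi) :
    arg (exp w) = w.im := by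
  rw [← log_im, log_exp h1 h2]

/-- A strongly starlike function is governed by a Schwarz function `ω`, via
`z f' / f = ((1 + ω) / (1 - ω)) ^ α`, here in differentiated form. -/
theorem IsStronglyStarlike.exists_schwarz {f : ℂ → ℂ} {α : ℝ} (hα : 0 < α) (hα1 : α ≤ 1)
    (hf : IsStronglyStarlike α f) :
    ∃ g ω : ℂ → ℂ, AnalyticAt ℂ g 0 ∧ g 0 = 1 ∧ DifferentiableOn ℂ ω (ball 0 1) ∧
      (∀ z ∈ ball (0 : ℂ) 1, ‖ω z‖ ≤ 1) ∧ ω 0 = 0 ∧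
      (∀ᶠ z in 𝓝 0, z * deriv f z = f z * g z) ∧
      ∀ᶠ z in 𝓝 0, deriv g z * (1 - ω z ^ 2) = 2 * α * deriv ω z * g z := by
  have hn : ball (0 : ℂ) 1 ∈ 𝓝 0 := ball_mem_nhds 0 one_pos
  have hα' : (α : ℂ) ≠ 0 := ofReal_ne_zero.2 hα.ne'
  have hds : DifferentiableOn ℂ (dslope f 0) (ball 0 1) :=
    (Complex.differentiableOn_dslope hn).2 hf.differentiableOn
  have hdf : DifferentiableOn ℂ (deriv f) (ball 0 1) := hf.differentiableOn.deriv isOpen_ball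
  have hds0 : dslope f 0 0 = 1 := by rw [dslope_same, hf.deriv_zero]
  have hmul : ∀ z, z * dslope f 0 z = f z := dslope_zero_mul hf.map_zero
  have hne : ∀ z ∈ ball (0 : ℂ) 1, dslope f 0 z ≠ 0 := by
    intro z hz h
    rcases eq_or_ne z 0 with rfl | h0
    · rw [hds0] at h; exact one_ne_zero h
    · exact hf.ne_zero z hz h0 (by rw [← hmul, h, mul_zero])
  set g : ℂ → ℂ := fun z => deriv f z / dslope f 0 z with hg
  have hgd : DifferentiableOn ℂ g (ball 0 1) := hdf.div hds hne
  have hg0 : g 0 = 1 := by simp [hg, hf.deriv_zero]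
  have hgz : ∀ z, z ≠ 0 → g z = z * deriv f z / f z := by
    intro z hz
    rw [← hmul z, hg, mul_div_mul_left _ _ hz]
  have harg : ∀ z ∈ ball (0 : ℂ) 1, |arg (g z)| < Real.pi * α / 2 := by
    intro z hz
    rcases eq_or_ne z 0 with rfl | h0
    · rw [hg0, arg_one, abs_zero]; positivity
    · rw [hgz z h0]; exact hf.abs_arg_lt z hz h0
  have hgne : ∀ z ∈ ball (0 : ℂ) 1, g z ≠ 0 := by
    intro z hz
    rcases eq_or_ne z 0 with rfl | h0
    · rw [hg0]; exact one_ne_zero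
    · exact div_ne_zero (hf.deriv_ne_zero z hz h0) (hne z hz)
  have hslit : ∀ z ∈ ball (0 : ℂ) 1, g z ∈ slitPlane := by
    intro z hz
    refine mem_slitPlane_iff_arg.2 ⟨fun h => ?_, hgne z hz⟩
    have := harg z hz
    rw [h, abs_of_pos Real.pi_pos] at this
    nlinarith [Real.pi_pos]
  -- `P = g^(1/α)` has argument below `π/2`, so its Cayley transform is the Schwarz function.
  set P : ℂ → ℂ := fun z => exp (log (g z) / α) with hP
  have hPre : ∀ z ∈ ball (0 : ℂ) 1, 0 < (P z).re := by
    intro z hz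
    rw [hP, exp_re]
    refine mul_pos (Real.exp_pos _) (Real.cos_pos_of_mem_Ioo ?_)
    rw [div_ofReal_im, log_im, Set.mem_Ioo, ← abs_lt, abs_div, abs_of_pos hα, div_lt_iff₀ hα]
    linarith [harg z hz]
  have hP1 : ∀ z ∈ ball (0 : ℂ) 1, P z + 1 ≠ 0 := by
    intro z hz h
    have := congrArg re h
    simp only [add_re, one_re, zero_re] at this
    linarith [hPre z hz]
  have hder : ∀ z ∈ ball (0 : ℂ) 1, HasDerivAt (fun z => (P z - 1) / (P z + 1))
      ((P z * (deriv g z / g z / α) * (P z + 1) - (P z - 1) * (P z * (deriv g z / g z / α))) /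
        (P z + 1) ^ 2) z := by
    intro z hz
    have h1 : HasDerivAt g (deriv g z) z :=
      (hgd.differentiableAt (isOpen_ball.mem_nhds hz)).hasDerivAt
    have h2 : HasDerivAt P (P z * (deriv g z / g z / α)) z :=
      ((h1.clog (hslit z hz)).div_const (α : ℂ)).cexp
    exact (h2.sub_const 1).div (h2.add_const 1) (hP1 z hz)
  refine ⟨g, fun z => (P z - 1) / (P z + 1), hgd.analyticAt hn, hg0,
    fun z hz => (hder z hz).differentiableAt.differentiableWithinAt, fun z hz => ?_, ?_, ?_, ?_⟩
  · rw [norm_div]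
    exact div_le_one_of_le₀ (re_pos_iff_norm_lt.1 (hPre z hz)).le (norm_nonneg _)
  · simp [hP, hg0]
  · filter_upwards [hn] with z hz
    have := hne z hz
    rw [← hmul z, hg]
    field_simp
  · filter_upwards [hn] with z hz
    rw [(hder z hz).deriv]
    have h1 := hgne z hz
    have h2 := hP1 z hz
    field_simp
    ring

/-- Every Schwarz function gives rise to a strongly starlike function of order `α`. -/
theorem exists_isStronglyStarlike {ω : ℂ → ℂ} {α : ℝ} (hα : 0 < α) (hα1 : α ≤ 1)
    (hω : DifferentiableOn ℂ ω (ball 0 1)) (hb : ∀ z ∈ ball (0 : ℂ) 1, ‖ω z‖ < 1) (h0 : ω 0 = 0) :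
    ∃ f g : ℂ → ℂ, IsStronglyStarlike α f ∧ AnalyticAt ℂ g 0 ∧ g 0 = 1 ∧
      (∀ᶠ z in 𝓝 0, z * deriv f z = f z * g z) ∧
      ∀ᶠ z in 𝓝 0, deriv g z * (1 - ω z ^ 2) = 2 * α * deriv ω z * g z := by
  have hn : ball (0 : ℂ) 1 ∈ 𝓝 0 := ball_mem_nhds 0 one_pos
  have h1ω : ∀ z ∈ ball (0 : ℂ) 1, 1 - ω z ≠ 0 := by
    intro z hz h
    have := hb z hz
    rw [← sub_eq_zero.1 h, norm_one] at this
    exact lt_irrefl _ this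
  have h2ω : ∀ z ∈ ball (0 : ℂ) 1, 1 + ω z ≠ 0 := by
    intro z hz h
    have := hb z hz
    rw [← neg_eq_of_add_eq_zero_right h, norm_neg, norm_one] at this
    exact lt_irrefl _ this
  set P : ℂ → ℂ := fun z => (1 + ω z) / (1 - ω z) with hP
  have hPre : ∀ z ∈ ball (0 : ℂ) 1, 0 < (P z).re := fun z hz => cayley_re_pos (hb z hz)
  set g : ℂ → ℂ := fun z => exp (α * log (P z)) with hg
  have hgder : ∀ z ∈ ball (0 : ℂ) 1, HasDerivAt g
      (g z * (α * ((deriv ω z * (1 - ω z) - (1 + ω z) * (-deriv ω z)) / (1 - ω z) ^ 2 / P z))) z := by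
    intro z hz
    have h1 : HasDerivAt ω (deriv ω z) z :=
      (hω.differentiableAt (isOpen_ball.mem_nhds hz)).hasDerivAt
    have h2 := (h1.const_add 1).div (h1.const_sub 1) (h1ω z hz)
    exact ((h2.clog (Or.inl (hPre z hz))).const_mul (α : ℂ)).cexp
  have hgd : DifferentiableOn ℂ g (ball 0 1) :=
    fun z hz => (hgder z hz).differentiableAt.differentiableWithinAt
  have hg0 : g 0 = 1 := by simp [hg, hP, h0]
  -- `K' = (g-1)/z` and `K 0 = 0`, so `f = z exp K` satisfies `z f'/f = g`.
  obtain ⟨K, hK0, hK⟩ := ((Complex.differentiableOn_dslope hn).2 hgd).isExactOn_ball.with_val_at 0 0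
  have hmul : ∀ z, z * dslope g 0 z = g z - 1 := fun z => by
    simpa [hg0] using sub_smul_dslope g 0 z
  have hfder : ∀ z ∈ ball (0 : ℂ) 1, HasDerivAt (fun z => z * exp (K z)) (exp (K z) * g z) z := by
    intro z hz
    refine ((hasDerivAt_id z).mul (hK z hz).cexp).congr_deriv ?_
    simp only [_root_.id]
    linear_combination exp (K z) * hmul z
  have hquot : ∀ z ∈ ball (0 : ℂ) 1, z ≠ 0 →
      z * deriv (fun z => z * exp (K z)) z / (z * exp (K z)) = g z := by
    intro z hz hz0
    rw [(hfder z hz).deriv, mul_div_mul_left _ _ hz0, mul_div_cancel_left₀ _ (exp_ne_zero _)]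
  refine ⟨fun z => z * exp (K z), g, ⟨⟨?_, by simp, ?_⟩, ?_, ?_, ?_⟩, hgd.analyticAt hn, hg0,
    ?_, ?_⟩
  · exact fun z hz => (hfder z hz).differentiableAt.differentiableWithinAt
  · rw [(hfder 0 (mem_ball_self one_pos)).deriv, hK0, hg0, exp_zero, one_mul]
  · exact fun z _ hz0 => mul_ne_zero hz0 (exp_ne_zero _)
  · intro z hz _
    rw [(hfder z hz).deriv]
    exact mul_ne_zero (exp_ne_zero _) (exp_ne_zero _)
  · intro z hz hz0
    have h1 : |arg (P z)| < Real.pi / 2 := abs_arg_lt_pi_div_two_iff.2 (Or.inl (hPre z hz))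
    have h2 : ((α : ℂ) * log (P z)).im = α * arg (P z) := by simp [log_im]
    have h3 : |α * arg (P z)| < Real.pi * α / 2 := by
      rw [abs_mul, abs_of_pos hα]; nlinarith
    have h4 := abs_lt.1 h3
    have h5 := Real.pi_pos
    rw [hquot z hz hz0, hg, arg_exp_of_mem (by rw [h2]; nlinarith) (by rw [h2]; nlinarith), h2]
    exact h3
  · filter_upwards [hn] with z hz
    rw [(hfder z hz).deriv]
    ring
  · filter_upwards [hn] with z hz
    rw [(hgder z hz).deriv, hP]
    have h1 := h1ω z hz
    have h2 := h2ω z hz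
    field_simp
    ring

/-- The Schwarz functions `z (c + z) / (1 + c z)`. -/
theorem exists_blaschke {c : ℝ} (hc : 0 ≤ c) (hc1 : c ≤ 1) :
    ∃ ω : ℂ → ℂ, DifferentiableOn ℂ ω (ball 0 1) ∧ (∀ z ∈ ball (0 : ℂ) 1, ‖ω z‖ < 1) ∧ ω 0 = 0 ∧
      HasJet ω 0 c (1 - c ^ 2) (-(c * (1 - c ^ 2))) := by
  have hn : ball (0 : ℂ) 1 ∈ 𝓝 0 := ball_mem_nhds 0 one_pos
  have hne : ∀ z ∈ ball (0 : ℂ) 1, 1 + c * z ≠ 0 := by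
    intro z hz h
    have h1 : ‖(c : ℂ) * z‖ = 1 := by
      rw [← neg_eq_of_add_eq_zero_right h, norm_neg, norm_one]
    rw [norm_mul, norm_real, Real.norm_of_nonneg hc] at h1
    nlinarith [mem_ball_zero_iff.1 hz, norm_nonneg z]
  have hd : DifferentiableOn ℂ (fun z : ℂ => z * ((c + z) / (1 + c * z))) (ball 0 1) :=
    differentiableOn_id.mul ((by fun_prop : DifferentiableOn ℂ (fun z : ℂ => c + z) (ball 0 1)).div
      (by fun_prop) hne)
  refine ⟨fun z => z * ((c + z) / (1 + c * z)), hd, fun z hz => ?_, by simp, ?_⟩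
  · rw [norm_mul, norm_div]
    have h1 := norm_sub_le_norm_one_sub_conj_mul (a := -(c : ℂ)) (b := z)
      (by simpa [abs_of_nonneg hc] using hc1) (mem_ball_zero_iff.1 hz).le
    have h2 : ‖(c : ℂ) + z‖ / ‖1 + c * z‖ ≤ 1 := by
      refine div_le_one_of_le₀ ?_ (norm_nonneg _)
      simpa [add_comm] using h1
    have := mem_ball_zero_iff.1 hz
    nlinarith [norm_nonneg z]
  · have hj := (hd.analyticAt hn).hasJet
    -- The jet is read off from `ω(z)(1 + cz) = cz + z²`.
    obtain ⟨-, h2, h3, h4⟩ := (hj.mul (HasJet.poly 1 c 0 0)).unique_of_eventuallyEq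
      (HasJet.poly 0 c 1 0) (by
        filter_upwards [hn] with z hz
        linear_combination z * div_mul_cancel₀ ((c : ℂ) + z) (hne z hz))
    simp only [zero_mul] at h2 h3 h4
    convert hj using 1
    · simp
    · linear_combination -h2
    · linear_combination -h3 + c * h2
    · linear_combination -h4 + c * h3 - c ^ 2 * h2

/-! ### The real inequality behind the vertex candidate. -/

/-- With `n = 35α²+4`, so that `75α² = 15/7 (n-4)`, this is the polynomial left after taking `M = D`
in `vertex_bound_linear` and removing a factor `1-s`. It is enough to test it at one corner `(m, σ)`
of a region; the proof moves in `n`, then in `s`. -/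
theorem vertex_poly_mono {m n s σ : ℝ} (hσ : 0 ≤ σ) (hs : σ ≤ s) (hs1 : s ≤ 1) (hm : 9 ≤ m)
    (hn : m ≤ n)
    (h : 0 ≤ 2 * m * (3 + σ) * (m * (1 + σ) - 9 - 3 * σ) -
      15 / 7 * (m - 4) * (9 - 6 * σ + (m - 3) * σ ^ 2)) :
    0 ≤ 2 * n * (3 + s) * (n * (1 + s) - 9 - 3 * s) -
      15 / 7 * (n - 4) * (9 - 6 * s + (n - 3) * s ^ 2) := by
  have h1 : 0 ≤ 2 * n * (3 + σ) * (n * (1 + σ) - 9 - 3 * σ) -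
      15 / 7 * (n - 4) * (9 - 6 * σ + (n - 3) * σ ^ 2) := by
    have : 0 ≤ (n - m) * (2 * (3 + σ) * ((n + m - 9) + (n + m - 3) * σ) -
        15 / 7 * (9 - 6 * σ) - 15 / 7 * σ ^ 2 * (n + m - 7)) := by
      refine mul_nonneg (by linarith) ?_
      have : σ ^ 2 * (n + m - 7) ≤ 1 * σ * (n + m - 7) := by
        have : 0 ≤ n + m - 7 := by linarith
        gcongr
        nlinarith
      have : 0 ≤ σ * (n + m - 3) := mul_nonneg hσ (by linarith)
      have : 0 ≤ σ * (n + m - 9) := mul_nonneg hσ (by linarith)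
      have : 0 ≤ σ * (σ * (n + m - 3)) := mul_nonneg hσ (mul_nonneg hσ (by linarith))
      nlinarith
    linarith
  have h2 : 0 ≤ (s - σ) * (2 * n * ((n - 9) + (n - 3) * σ) + 2 * n * (3 + s) * (n - 3) +
      90 / 7 * (n - 4) - 15 / 7 * (n - 4) * (n - 3) * (s + σ)) := by
    refine mul_nonneg (by linarith) ?_
    have a1 : (n - 4) * (n - 3) * (s + σ) ≤ n * (n - 3) * (s + σ) := by
      have : 0 ≤ n - 3 := by linarith
      have : 0 ≤ s + σ := by linarith
      gcongr
      linarith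
    have a2 : 0 ≤ n * (n - 3) := mul_nonneg (by linarith) (by linarith)
    have a3 : 0 ≤ n * (n - 9) := mul_nonneg (by linarith) (by linarith)
    have a4 : n * (n - 3) * (15 / 7 * (s + σ)) ≤ n * (n - 3) * (2 * σ + 2 * (3 + s)) := by
      gcongr
      linarith
    nlinarith
  linarith

/-- The case `M = 1`. Since `α² ≤ s/5`, the term with `75α²` is at most a multiple of `s`, and the
gap between `9` and the first factor pays for it. -/
theorem vertex_poly_small {α s : ℝ} (hα : 0 < α) (hs : 0 < s) (hs1 : s < 1) (h20 : α ≤ 20 / 100)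
    (h : α ≤ s) :
    (9 - 6 * s + (35 * α ^ 2 + 1) * s ^ 2) *
      (2 * (35 * α ^ 2 + 4) * (3 + s) + 75 * α ^ 2 * (1 - s)) ≤
      18 * 1 * ((35 * α ^ 2 + 4) * (3 + s)) := by
  have hs1' : 0 < 1 - s := by linarith
  have ha : α ^ 2 ≤ 1 / 5 * s := by nlinarith
  have h2 : α ^ 2 ≤ 1 / 25 := by nlinarith
  have h4 : s * (6 - 2.4 * s) ≤ 6 * s - (35 * α ^ 2 + 1) * s ^ 2 := by
    have : (35 * α ^ 2 + 1) * s ^ 2 ≤ 2.4 * s ^ 2 := by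
      gcongr
      linarith
    linarith
  have h0 : 0 < s * (6 - 2.4 * s) := mul_pos hs (by linarith)
  have hn : 75 * α ^ 2 * (1 - s) * (9 - 6 * s + (35 * α ^ 2 + 1) * s ^ 2) ≤
      75 * (1 / 5 * s) * (1 - s) * 9 := by
    have : 9 - 6 * s + (35 * α ^ 2 + 1) * s ^ 2 ≤ 9 := by linarith
    have : 0 ≤ 9 - 6 * s + (35 * α ^ 2 + 1) * s ^ 2 := by
      have : 0 ≤ (35 * α ^ 2 + 1) * s ^ 2 := by positivity
      linarith
    gcongr
  have h5 : 2 * (4 * 3) * (s * (6 - 2.4 * s)) ≤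
      2 * ((35 * α ^ 2 + 4) * (3 + s)) * (6 * s - (35 * α ^ 2 + 1) * s ^ 2) := by
    have : 4 ≤ 35 * α ^ 2 + 4 := by nlinarith
    gcongr
    linarith
  have h6 : 75 * (1 / 5 * s) * (1 - s) * 9 ≤ 2 * (4 * 3) * (s * (6 - 2.4 * s)) := by
    nlinarith
  linarith

/-- The regime in which the vertex of the quadratic in `cos θ` lies in `[-1, 1]`. -/
theorem vertex_bound_linear {α s M : ℝ} (hα : 0 < α) (hα1 : α ≤ 1) (hs : 0 < s) (hs1 : s < 1)
    (hD : (35 * α ^ 2 + 4) / 9 ≤ M)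
    (hM : ∀ s : ℝ, 0 ≤ s → s ≤ 1 →
      1 + s * (10 * α - 2) / 3 - s ^ 2 * (35 * α ^ 2 + 30 * α + 7) / 9 ≤ M)
    (hc : 5 * α * (9 - 6 * s - 3 * s ^ 2 - (35 * α ^ 2 + 4) * s ^ 2) ≤
      2 * (35 * α ^ 2 + 4) * s * (3 + s)) :
    (9 - 6 * s + (35 * α ^ 2 + 1) * s ^ 2) *
      (2 * (35 * α ^ 2 + 4) * (3 + s) + 75 * α ^ 2 * (1 - s)) ≤
      18 * M * ((35 * α ^ 2 + 4) * (3 + s)) := by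
  have hM1 : 1 ≤ M := by simpa using hM 0 le_rfl zero_le_one
  have hN : 0 < (35 * α ^ 2 + 4) * (3 + s) := by positivity
  -- For larger `α` the bound `M ≥ D` suffices; for smaller `α`, `small` uses a numerical lower
  -- bound `m` for `M`.
  have large : 0 ≤ 2 * (35 * α ^ 2 + 4) * (3 + s) * ((35 * α ^ 2 + 4) * (1 + s) - 9 - 3 * s) -
      75 * α ^ 2 * (9 - 6 * s + (35 * α ^ 2 + 1) * s ^ 2) → (9 - 6 * s + (35 * α ^ 2 + 1) * s ^ 2) *
      (2 * (35 * α ^ 2 + 4) * (3 + s) + 75 * α ^ 2 * (1 - s)) ≤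
      18 * M * ((35 * α ^ 2 + 4) * (3 + s)) := by
    intro h
    nlinarith [mul_nonneg h (sub_nonneg.2 hs1.le), mul_le_mul_of_nonneg_right hD hN.le]
  have small : ∀ m : ℝ, m ≤ M → (9 - 6 * s + (35 * α ^ 2 + 1) * s ^ 2) *
      (2 * (35 * α ^ 2 + 4) * (3 + s) + 75 * α ^ 2 * (1 - s)) ≤
      18 * m * ((35 * α ^ 2 + 4) * (3 + s)) → (9 - 6 * s + (35 * α ^ 2 + 1) * s ^ 2) *
      (2 * (35 * α ^ 2 + 4) * (3 + s) + 75 * α ^ 2 * (1 - s)) ≤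
      18 * M * ((35 * α ^ 2 + 4) * (3 + s)) := by
    intro m hm h
    nlinarith [mul_le_mul_of_nonneg_right hm hN.le]
  -- In `hc` the left side decreases and the right side increases with `s`, so failure at `σ` forces
  -- `s ≥ σ`.
  have fails : ∀ {σ : ℝ}, s < σ → 2 * (35 * α ^ 2 + 4) * σ * (3 + σ) <
      5 * α * (9 - 6 * σ - 3 * σ ^ 2 - (35 * α ^ 2 + 4) * σ ^ 2) → False := by
    intro σ hσ h
    have hσ0 : 0 < σ := hs.trans hσ
    have h1 : (35 * α ^ 2 + 4) * s * (3 + s) ≤ (35 * α ^ 2 + 4) * σ * (3 + σ) := by gcongr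
    have h2 : s ^ 2 ≤ σ ^ 2 := by gcongr
    have h3 : 5 * α * (9 - 6 * σ - 3 * σ ^ 2 - (35 * α ^ 2 + 4) * σ ^ 2) ≤
        5 * α * (9 - 6 * s - 3 * s ^ 2 - (35 * α ^ 2 + 4) * s ^ 2) := by gcongr
    linarith
  -- The ratio of the two sides grows with `α`, so the right end `β` of an `α`-interval decides.
  have small_of : ∀ {m : ℝ} (β : ℝ), 0 < β → α ≤ β → (9 - 6 * s + (35 * β ^ 2 + 1) * s ^ 2) *
      (2 * (35 * β ^ 2 + 4) * (3 + s) + 75 * β ^ 2 * (1 - s)) ≤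
      18 * m * ((35 * β ^ 2 + 4) * (3 + s)) → (9 - 6 * s + (35 * α ^ 2 + 1) * s ^ 2) *
      (2 * (35 * α ^ 2 + 4) * (3 + s) + 75 * α ^ 2 * (1 - s)) ≤
      18 * m * ((35 * α ^ 2 + 4) * (3 + s)) := by
    intro m β hβ hle h
    have h2 : α ^ 2 ≤ β ^ 2 := by gcongr
    have hs1' : 0 < 1 - s := by linarith
    have hX : 0 < 9 - 6 * s + (35 * α ^ 2 + 1) * s ^ 2 := by nlinarith [sq_nonneg (α * s)]
    have hY : 0 < 9 - 6 * s + (35 * β ^ 2 + 1) * s ^ 2 := by nlinarith [sq_nonneg (β * s)]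
    have h3 : (2 * (35 * α ^ 2 + 4) * (3 + s) + 75 * α ^ 2 * (1 - s)) * (35 * β ^ 2 + 4) ≤
        (35 * α ^ 2 + 4) * (2 * (35 * β ^ 2 + 4) * (3 + s) + 75 * β ^ 2 * (1 - s)) := by
      nlinarith [mul_le_mul_of_nonneg_right h2 hs1'.le]
    refine le_of_mul_le_mul_right ?_ (show 0 < 35 * β ^ 2 + 4 by positivity)
    calc _ = (9 - 6 * s + (35 * α ^ 2 + 1) * s ^ 2) *
          ((2 * (35 * α ^ 2 + 4) * (3 + s) + 75 * α ^ 2 * (1 - s)) * (35 * β ^ 2 + 4)) := by ring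
      _ ≤ (9 - 6 * s + (35 * β ^ 2 + 1) * s ^ 2) *
          ((35 * α ^ 2 + 4) * (2 * (35 * β ^ 2 + 4) * (3 + s) + 75 * β ^ 2 * (1 - s))) := by
        gcongr
      _ = (35 * α ^ 2 + 4) * ((9 - 6 * s + (35 * β ^ 2 + 1) * s ^ 2) *
          (2 * (35 * β ^ 2 + 4) * (3 + s) + 75 * β ^ 2 * (1 - s))) := by ring
      _ ≤ (35 * α ^ 2 + 4) * (18 * m * ((35 * β ^ 2 + 4) * (3 + s))) := by gcongr
      _ = _ := by ring
  have large_of : ∀ {β : ℝ} (σ : ℝ), 0 ≤ σ → σ ≤ s → β ≤ α → 5 ≤ 35 * β ^ 2 → 0 < β →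
      0 ≤ 2 * (35 * β ^ 2 + 4) * (3 + σ) * ((35 * β ^ 2 + 4) * (1 + σ) - 9 - 3 * σ) -
        75 * β ^ 2 * (9 - 6 * σ + (35 * β ^ 2 + 1) * σ ^ 2) →
      0 ≤ 2 * (35 * α ^ 2 + 4) * (3 + s) * ((35 * α ^ 2 + 4) * (1 + s) - 9 - 3 * s) -
        75 * α ^ 2 * (9 - 6 * s + (35 * α ^ 2 + 1) * s ^ 2) := by
    intro β σ hσ hσs hβ hβ5 hβ0 h
    have h2 : β ^ 2 ≤ α ^ 2 := by gcongr
    have e : ∀ γ : ℝ, 75 * γ ^ 2 = 15 / 7 * ((35 * γ ^ 2 + 4) - 4) := fun γ => by ring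
    have e1 : ∀ γ : ℝ, 35 * γ ^ 2 + 1 = (35 * γ ^ 2 + 4) - 3 := fun γ => by ring
    rw [e, e1] at h ⊢
    exact vertex_poly_mono hσ hσs hs1.le (by linarith) (by linarith) h
  rcases le_or_gt (45 / 100) α with h45 | h45
  · apply large
    exact large_of 0 (by norm_num) hs.le h45 (by norm_num) (by norm_num) (by norm_num)
  rcases le_or_gt (42 / 100) α with h42 | h42
  · have : 1 / 10 ≤ s := by
      by_contra! h
      exact fails h (by nlinarith)
    apply large
    exact large_of (1 / 10) (by norm_num) this h42 (by norm_num) (by norm_num) (by norm_num)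
  rcases le_or_gt (385 / 1000) α with h385 | h385
  · have : 22 / 100 ≤ s := by
      by_contra! h
      exact fails h (by nlinarith)
    apply large
    exact large_of (22 / 100) (by norm_num) this h385 (by norm_num) (by norm_num) (by norm_num)
  rcases le_or_gt (35 / 100) α with h35 | h35
  · have : 22 / 100 ≤ s := by
      by_contra! h
      exact fails h (by nlinarith)
    refine small (1.0257) ?_ ?_
    -- `0.103` is nearly the maximizer of `Q` at `α = 0.35`, the left end of the interval; `0.078`
    -- below plays the same role for `α = 0.30`.
    · refine le_trans ?_ (hM (0.103) (by norm_num) (by norm_num))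
      nlinarith
    refine small_of (385/1000) (by norm_num) h385.le ?_
    nlinarith [mul_nonneg (sub_nonneg.2 this) (sub_nonneg.2 hs1.le), mul_nonneg (mul_nonneg (sub_nonneg.2 this) (sub_nonneg.2 hs1.le)) hs.le]
  rcases le_or_gt (30 / 100) α with h30 | h30
  · have : 22 / 100 ≤ s := by
      by_contra! h
      exact fails h (by nlinarith)
    refine small (1.013) ?_ ?_
    · refine le_trans ?_ (hM (0.078) (by norm_num) (by norm_num))
      nlinarith
    refine small_of (35/100) (by norm_num) h35.le ?_
    nlinarith [mul_nonneg (sub_nonneg.2 this) (sub_nonneg.2 hs1.le), mul_nonneg (mul_nonneg (sub_nonneg.2 this) (sub_nonneg.2 hs1.le)) hs.le]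
  rcases le_or_gt (20 / 100) α with h20 | h20
  · have : 20 / 100 ≤ s := by
      by_contra! h
      exact fails h (by nlinarith)
    refine small 1 hM1 ?_
    refine small_of (30/100) (by norm_num) h30.le ?_
    nlinarith [mul_nonneg (sub_nonneg.2 this) (sub_nonneg.2 hs1.le), mul_nonneg (mul_nonneg (sub_nonneg.2 this) (sub_nonneg.2 hs1.le)) hs.le]
  · have : α ≤ s := by
      by_contra! h
      refine fails h ?_
      have : 0 < 45 - 30 * α - 15 * α ^ 2 - 5 * (35 * α ^ 2 + 4) * α ^ 2 -
          2 * (35 * α ^ 2 + 4) * (3 + α) := by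
        have h2 : α ^ 2 ≤ 1 / 25 := by nlinarith
        nlinarith [mul_nonneg hα.le (sub_nonneg.2 h2), mul_nonneg (sq_nonneg α) (sub_nonneg.2 h2)]
      nlinarith
    refine small 1 hM1 ?_
    exact vertex_poly_small hα hs hs1 h20.le this

/-! ### Maximizing over the angle and over `ρ`. -/

section TrigQuadratic

variable {A B C E ρ u : ℝ}

/-- Complete the square in `u`; the value at the vertex is the bound. -/
theorem sq_le_of_vertex (hAC : 0 < 4 * A * C) {q : ℝ} (hq : B ^ 2 = 4 * A * C * q)
    (hE : E ^ 2 = (A + C * ρ ^ 2) ^ 2 + B ^ 2 * ρ ^ 2 - 2 * B * ρ * u * (A - C * ρ ^ 2) -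
      4 * A * C * ρ ^ 2 * u ^ 2) :
    E ^ 2 ≤ (A + C * ρ ^ 2) ^ 2 * (1 + q) := by
  refine le_of_mul_le_mul_left ?_ hAC
  have h : 4 * A * C * ((A + C * ρ ^ 2) ^ 2 * (1 + q)) =
      4 * A * C * (A + C * ρ ^ 2) ^ 2 + B ^ 2 * (A + C * ρ ^ 2) ^ 2 := by rw [hq]; ring
  rw [h, hE]
  nlinarith [sq_nonneg (4 * A * C * ρ * u + B * (A - C * ρ ^ 2))]

/-- `hc` places the vertex outside `(-1,1)`, so the maximum is at `u = ±1`, where `E²` is a perfect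
square. -/
theorem le_of_endpoint (hA : 0 ≤ A) (hB : 0 ≤ B) (hC : 0 ≤ C) (hρ : 0 ≤ ρ) (hu : |u| ≤ 1)
    (hc : 4 * A * C * ρ ≤ B * |A - C * ρ ^ 2|)
    (hE : E ^ 2 = (A + C * ρ ^ 2) ^ 2 + B ^ 2 * ρ ^ 2 - 2 * B * ρ * u * (A - C * ρ ^ 2) -
      4 * A * C * ρ ^ 2 * u ^ 2) :
    E ≤ |A - C * ρ ^ 2| + B * ρ := by
  refine le_of_sq_le_sq ?_ (by positivity)
  have h1 : -(u * (A - C * ρ ^ 2)) ≤ |u| * |A - C * ρ ^ 2| := by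
    rw [← abs_mul]; exact neg_le_abs _
  have h2 : 0 ≤ |u| := abs_nonneg u
  have h3 : 0 ≤ (1 - |u|) * ρ * (B * |A - C * ρ ^ 2| - 4 * A * C * ρ) :=
    mul_nonneg (mul_nonneg (by linarith) hρ) (by linarith)
  have h4 : 0 ≤ A * C * ρ ^ 2 * (1 - |u|) ^ 2 := by positivity
  have h5 := mul_le_mul_of_nonneg_left h1 (mul_nonneg hB hρ)
  rw [hE]
  have h6 : (|A - C * ρ ^ 2| + B * ρ) ^ 2 =
      (A - C * ρ ^ 2) ^ 2 + 2 * B * ρ * |A - C * ρ ^ 2| + B ^ 2 * ρ ^ 2 := by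
    rw [add_sq, sq_abs]; ring
  rw [h6, ← sq_abs u]
  nlinarith

/-- The bound for `max_u E + κ (1 - ρ²)` in terms of the three critical configurations. -/
theorem le_of_critical_bounds {κ q M : ℝ} (hA : 0 < A) (hB : 0 < B) (hC : 0 < C) (hκ : 0 ≤ κ)
    (hκC : κ ≤ C) (hρ : 0 ≤ ρ) (hρ1 : ρ ≤ 1) (hu : |u| ≤ 1) (hq : B ^ 2 = 4 * A * C * q)
    (hE : E ^ 2 = (A + C * ρ ^ 2) ^ 2 + B ^ 2 * ρ ^ 2 - 2 * B * ρ * u * (A - C * ρ ^ 2) -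
      4 * A * C * ρ ^ 2 * u ^ 2)
    (h1 : C - A + B ≤ M) (h2 : A + κ + B ^ 2 / (4 * (C + κ)) ≤ M)
    (h3 : B * (C - A) ≤ 4 * A * C → (A + C) * √(1 + q) ≤ M) :
    E + κ * (1 - ρ ^ 2) ≤ M := by
  have hAC : 0 < 4 * A * C := by positivity
  have hq0 : 0 ≤ q := by
    by_contra! h
    nlinarith [mul_neg_of_pos_of_neg hAC h, sq_nonneg B]
  have hK : 1 ≤ √(1 + q) := Real.one_le_sqrt.2 (by linarith)
  have hK2 : √(1 + q) ^ 2 = 1 + q := Real.sq_sqrt (by linarith)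
  have hvert : E ≤ (A + C * ρ ^ 2) * √(1 + q) := by
    refine le_of_sq_le_sq ?_ (by positivity)
    rw [mul_pow, hK2]
    exact sq_le_of_vertex hAC hq hE
  have hmono : ∀ r : ℝ, ρ ≤ r → (A + C * ρ ^ 2) * √(1 + q) + κ * (1 - ρ ^ 2) ≤
      (A + C * r ^ 2) * √(1 + q) + κ * (1 - r ^ 2) := by
    intro r hr
    have : ρ ^ 2 ≤ r ^ 2 := by gcongr
    have hCK : κ ≤ C * √(1 + q) := by nlinarith
    nlinarith [mul_nonneg (sub_nonneg.2 this) (sub_nonneg.2 hCK)]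
  have hend : ∀ r : ℝ, 0 ≤ r → r ≤ 1 → C * r ^ 2 - A + B * r + κ * (1 - r ^ 2) ≤ M := by
    intro r hr hr1
    have : r ^ 2 ≤ 1 := by nlinarith
    nlinarith
  -- The vertex bound increases with `ρ` because `κ ≤ C`, so here it may be pushed to `ρ = 1`.
  by_cases hc : B * (C - A) ≤ 4 * A * C
  · have := hmono 1 hρ1
    have := h3 hc
    norm_num at *
    linarith
  push Not at hc
  by_cases hr1 : 4 * A * C * ρ ≤ B * (C * ρ ^ 2 - A)
  · have hpos : 0 ≤ C * ρ ^ 2 - A := by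
      by_contra! h
      nlinarith [mul_neg_of_pos_of_neg hB h, mul_nonneg hAC.le hρ]
    have habs : |A - C * ρ ^ 2| = C * ρ ^ 2 - A := by rw [abs_sub_comm, abs_of_nonneg hpos]
    have := le_of_endpoint hA.le hB.le hC.le hρ hu (by rw [habs]; exact hr1) hE
    rw [habs] at this
    linarith [hend ρ hρ hρ1]
  by_cases hr2 : 4 * A * C * ρ ≤ B * (A - C * ρ ^ 2)
  · have hpos : 0 ≤ A - C * ρ ^ 2 := by
      by_contra! h
      nlinarith [mul_neg_of_pos_of_neg hB h, mul_nonneg hAC.le hρ]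
    have habs : |A - C * ρ ^ 2| = A - C * ρ ^ 2 := abs_of_nonneg hpos
    have h4 := le_of_endpoint hA.le hB.le hC.le hρ hu (by rw [habs]; exact hr2) hE
    rw [habs] at h4
    have hCκ : 0 < C + κ := by linarith
    have h5 : B * ρ - (C + κ) * ρ ^ 2 ≤ B ^ 2 / (4 * (C + κ)) := by
      rw [le_div_iff₀ (by positivity)]
      nlinarith [sq_nonneg (B - 2 * (C + κ) * ρ)]
    linarith
  push Not at hr1
  -- The vertex is interior at `ρ` but beyond `u = 1` at `ρ = 1`; at the intermediate `r` it sits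
  -- exactly at `u = 1`, and there the vertex and endpoint bounds coincide.
  obtain ⟨r, ⟨hρr, hr1'⟩, hr⟩ : ∃ r ∈ Set.Icc ρ 1, B * (C * r ^ 2 - A) - 4 * A * C * r = 0 := by
    refine intermediate_value_Icc hρ1 (f := fun r => B * (C * r ^ 2 - A) - 4 * A * C * r)
      (by fun_prop) ⟨by linarith, by norm_num; linarith⟩
  have hr0 : 0 ≤ r := hρ.trans hρr
  have hpos : 0 ≤ C * r ^ 2 - A := by
    by_contra! h
    nlinarith [mul_neg_of_pos_of_neg hB h, mul_nonneg hAC.le hr0]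
  have hqr : q * (C * r ^ 2 - A) ^ 2 = 4 * A * C * r ^ 2 := by
    have : B ^ 2 * (C * r ^ 2 - A) ^ 2 = (4 * A * C * r) ^ 2 := by
      rw [← mul_pow]; congr 1; linarith
    rw [hq] at this
    exact mul_left_cancel₀ hAC.ne' (by linarith)
  have heq : (A + C * r ^ 2) * √(1 + q) ≤ C * r ^ 2 - A + B * r := by
    refine le_of_sq_le_sq ?_ (by positivity)
    rw [mul_pow, hK2]
    have : (C * r ^ 2 - A + B * r) ^ 2 = (C * r ^ 2 - A) ^ 2 +
      2 * r * (B * (C * r ^ 2 - A)) + B ^ 2 * r ^ 2 := by ring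
    rw [this, show B * (C * r ^ 2 - A) = 4 * A * C * r by linarith, hq]
    refine le_of_eq ?_
    linear_combination hqr
  linarith [hmono r hρr, hend r hr0 hr1']

end TrigQuadratic

/-- `u` is the cosine of the angle between `w` and `x`, or `0` when one of them vanishes. -/
theorem norm_sq_trinomial (D b C : ℝ) (w x : ℂ) :
    ∃ u : ℝ, |u| ≤ 1 ∧ ‖D * w ^ 2 - b * w * x - C * x ^ 2‖ ^ 2 =
      (D * ‖w‖ ^ 2 + C * ‖x‖ ^ 2) ^ 2 + (b * ‖w‖) ^ 2 * ‖x‖ ^ 2 -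
        2 * (b * ‖w‖) * ‖x‖ * u * (D * ‖w‖ ^ 2 - C * ‖x‖ ^ 2) -
        4 * (D * ‖w‖ ^ 2) * C * ‖x‖ ^ 2 * u ^ 2 := by
  set r := w.re * x.re + w.im * x.im with hr
  have hw : ‖w‖ ^ 2 = w.re ^ 2 + w.im ^ 2 := by rw [← normSq_eq_norm_sq, normSq_apply]; ring
  have hx : ‖x‖ ^ 2 = x.re ^ 2 + x.im ^ 2 := by rw [← normSq_eq_norm_sq, normSq_apply]; ring
  have hle : |r| ≤ ‖w‖ * ‖x‖ := by
    refine abs_le_of_sq_le_sq ?_ (by positivity)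
    rw [mul_pow, hw, hx, hr]
    nlinarith [sq_nonneg (w.re * x.im - w.im * x.re)]
  obtain ⟨u, hu, hur⟩ : ∃ u : ℝ, |u| ≤ 1 ∧ r = ‖w‖ * ‖x‖ * u := by
    rcases eq_or_ne (‖w‖ * ‖x‖) 0 with h0 | h0
    · refine ⟨0, by simp, ?_⟩
      rw [h0, abs_nonpos_iff] at hle
      rw [hle, mul_zero]
    · refine ⟨r / (‖w‖ * ‖x‖), ?_, by rw [← mul_div_assoc, mul_div_cancel_left₀ _ h0]⟩
      rw [abs_div, abs_of_nonneg (by positivity : 0 ≤ ‖w‖ * ‖x‖)]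
      exact div_le_one_of_le₀ hle (by positivity)
  refine ⟨u, hu, ?_⟩
  have h1 : ‖D * w ^ 2 - b * w * x - C * x ^ 2‖ ^ 2 =
      (D * ‖w‖ ^ 2 + C * ‖x‖ ^ 2) ^ 2 + b ^ 2 * ‖w‖ ^ 2 * ‖x‖ ^ 2 -
        2 * b * r * (D * ‖w‖ ^ 2 - C * ‖x‖ ^ 2) - 4 * D * C * r ^ 2 := by
    rw [← normSq_eq_norm_sq, normSq_apply, hw, hx, hr]
    simp [pow_two]
    ring
  rw [h1, hur]
  ring

/-! ### The critical candidates and the bound for Schwarz functions. -/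

/-- Shrinking the denominator to `4(1-t²)` leaves an expression affine in `α²`. At `α² = 1/7`, where
`D = 1`, it is at most 1; its slope is nonnegative and at most that of `D`. So `1 ≤ M` settles
smaller `α` and `D ≤ M` larger ones. -/
theorem third_critical_bound {α t M : ℝ} (ht : 0 ≤ t) (ht1 : t < 1)
    (hD : (35 * α ^ 2 + 4) / 9 ≤ M) (hM : 1 ≤ M) :
    (35 * α ^ 2 + 4) / 9 * (t ^ 2) ^ 2 + 4 / 3 * t * (1 - t ^ 2) +
      (10 / 3 * α * (1 - t ^ 2) * t ^ 2) ^ 2 /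
        (4 * ((1 - t ^ 2) * (1 + t ^ 2 / 3) + 4 / 3 * t * (1 - t ^ 2))) ≤ M := by
  have hs : 0 < 1 - t ^ 2 := by nlinarith
  have h1 : (10 / 3 * α * (1 - t ^ 2) * t ^ 2) ^ 2 /
      (4 * ((1 - t ^ 2) * (1 + t ^ 2 / 3) + 4 / 3 * t * (1 - t ^ 2))) ≤
      (10 / 3 * α * (1 - t ^ 2) * t ^ 2) ^ 2 / (4 * (1 - t ^ 2)) := by
    gcongr
    nlinarith [mul_nonneg hs.le (sq_nonneg t), mul_nonneg hs.le ht]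
  have h2 : (10 / 3 * α * (1 - t ^ 2) * t ^ 2) ^ 2 / (4 * (1 - t ^ 2)) =
      25 / 9 * α ^ 2 * (t ^ 2) ^ 2 * (1 - t ^ 2) := by
    field_simp
    ring
  have h3 : t ^ 2 ≤ 1 := by linarith
  have h4 : 0 ≤ (1 - t ^ 2) * (1 + t ^ 2 - 4 / 3 * t - 25 / 63 * (t ^ 2) ^ 2) := by
    refine mul_nonneg hs.le ?_
    nlinarith [sq_nonneg (t - 2 / 3), sq_nonneg t]
  have h5 : 0 ≤ 35 * (t ^ 2) ^ 2 + 25 * ((t ^ 2) ^ 2 * (1 - t ^ 2)) := by positivity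
  have h6 : 0 ≤ 35 - 35 * (t ^ 2) ^ 2 - 25 * ((t ^ 2) ^ 2 * (1 - t ^ 2)) := by
    nlinarith [sq_nonneg t]
  rcases le_total (α ^ 2) (1 / 7) with h | h
  · nlinarith [mul_nonneg (sub_nonneg.2 h) h5]
  · nlinarith [mul_nonneg (sub_nonneg.2 h) h6]

theorem second_critical_bound {α s M : ℝ} (hα : 0 < α) (hα1 : α ≤ 1) (hs : 0 < s) (hs1 : s < 1)
    (hD : (35 * α ^ 2 + 4) / 9 ≤ M)
    (hM : ∀ s : ℝ, 0 ≤ s → s ≤ 1 →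
      1 + s * (10 * α - 2) / 3 - s ^ 2 * (35 * α ^ 2 + 30 * α + 7) / 9 ≤ M)
    (hc : 10 / 3 * α * (1 - s) * s * ((1 - s) * (1 + s / 3) - (35 * α ^ 2 + 4) / 9 * s ^ 2) ≤
      4 * ((35 * α ^ 2 + 4) / 9 * s ^ 2) * ((1 - s) * (1 + s / 3))) :
    ((35 * α ^ 2 + 4) / 9 * s ^ 2 + (1 - s) * (1 + s / 3)) *
      √(1 + 75 * α ^ 2 * (1 - s) / ((35 * α ^ 2 + 4) * (3 + s))) ≤ M := by
  have hs1' : 0 < 1 - s := by linarith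
  have hN : 0 < (35 * α ^ 2 + 4) * (3 + s) := by positivity
  have hc' : 5 * α * (9 - 6 * s - 3 * s ^ 2 - (35 * α ^ 2 + 4) * s ^ 2) ≤
      2 * (35 * α ^ 2 + 4) * s * (3 + s) := by
    have : 0 < s * (1 - s) := mul_pos hs hs1'
    refine le_of_mul_le_mul_left ?_ this
    nlinarith
  have h := vertex_bound_linear hα hα1 hs hs1 hD hM hc'
  -- `√(1+q) ≤ 1 + q/2` makes the claim polynomial.
  have hsq : √(1 + 75 * α ^ 2 * (1 - s) / ((35 * α ^ 2 + 4) * (3 + s))) ≤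
      1 + 75 * α ^ 2 * (1 - s) / ((35 * α ^ 2 + 4) * (3 + s)) / 2 := by
    refine Real.sqrt_le_iff.2 ⟨by positivity, ?_⟩
    nlinarith [sq_nonneg (75 * α ^ 2 * (1 - s) / ((35 * α ^ 2 + 4) * (3 + s)))]
  have hAC : 0 ≤ (35 * α ^ 2 + 4) / 9 * s ^ 2 + (1 - s) * (1 + s / 3) := by positivity
  refine (mul_le_mul_of_nonneg_left hsq hAC).trans ?_
  have e : ((35 * α ^ 2 + 4) / 9 * s ^ 2 + (1 - s) * (1 + s / 3)) *
      (1 + 75 * α ^ 2 * (1 - s) / ((35 * α ^ 2 + 4) * (3 + s)) / 2) =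
      (9 - 6 * s + (35 * α ^ 2 + 1) * s ^ 2) *
      (2 * (35 * α ^ 2 + 4) * (3 + s) + 75 * α ^ 2 * (1 - s)) /
        (18 * ((35 * α ^ 2 + 4) * (3 + s))) := by
    field_simp
    ring
  rw [e, div_le_iff₀ (by positivity)]
  linarith

open ComplexConjugate in
/-- The sharp bound of the Hankel functional in terms of the Schur parameters of a Schwarz
function. -/
theorem norm_hankel_le {α M : ℝ} (hα : 0 < α) (hα1 : α ≤ 1)
    (hD : (35 * α ^ 2 + 4) / 9 ≤ M)
    (hM : ∀ s : ℝ, 0 ≤ s → s ≤ 1 →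
      1 + s * (10 * α - 2) / 3 - s ^ 2 * (35 * α ^ 2 + 30 * α + 7) / 9 ≤ M)
    {c x y : ℂ} (hc : ‖c‖ ≤ 1) (hx : ‖x‖ ≤ 1) (hy : ‖y‖ ≤ 1) {c₂ c₃ : ℂ}
    (h₂ : c₂ = (1 - ‖c‖ ^ 2) * x)
    (h₃ : c₃ = (1 - ‖c‖ ^ 2) * ((1 - ‖x‖ ^ 2) * y - conj c * x ^ 2)) :
    ‖4 / 3 * c * c₃ - c₂ ^ 2 - 10 / 3 * α * c ^ 2 * c₂ + (35 * α ^ 2 + 4) / 9 * c ^ 4‖ ≤ M := by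
  have hM1 : 1 ≤ M := by simpa using hM 0 le_rfl zero_le_one
  set t := ‖c‖ with ht
  have ht0 : 0 ≤ t := norm_nonneg c
  have hcc : c * conj c = (t : ℂ) ^ 2 := by rw [mul_conj, normSq_eq_norm_sq]; simp [ht]
  have hs1 : 0 ≤ 1 - t ^ 2 := by nlinarith
  have hρ1 : 0 ≤ 1 - ‖x‖ ^ 2 := by nlinarith [norm_nonneg x]
  have e : 4 / 3 * c * c₃ - c₂ ^ 2 - 10 / 3 * α * c ^ 2 * c₂ + (35 * α ^ 2 + 4) / 9 * c ^ 4 =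
      (((35 * α ^ 2 + 4) / 9 : ℝ) * (c ^ 2) ^ 2 - (10 / 3 * α * (1 - t ^ 2) : ℝ) * c ^ 2 * x -
        ((1 - t ^ 2) * (1 + t ^ 2 / 3) : ℝ) * x ^ 2) +
      (4 / 3 * (1 - t ^ 2) * (1 - ‖x‖ ^ 2) : ℝ) * (c * y) := by
    rw [h₂, h₃]
    push_cast
    linear_combination (-(4 : ℂ) / 3 * (1 - t ^ 2) * x ^ 2) * hcc
  obtain ⟨u, hu, hE⟩ := norm_sq_trinomial ((35 * α ^ 2 + 4) / 9) (10 / 3 * α * (1 - t ^ 2))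
    ((1 - t ^ 2) * (1 + t ^ 2 / 3)) (c ^ 2) x
  set E := ‖((35 * α ^ 2 + 4) / 9 : ℝ) * (c ^ 2) ^ 2 - (10 / 3 * α * (1 - t ^ 2) : ℝ) * c ^ 2 * x -
        ((1 - t ^ 2) * (1 + t ^ 2 / 3) : ℝ) * x ^ 2‖ with hEdef
  have hle : ‖4 / 3 * c * c₃ - c₂ ^ 2 - 10 / 3 * α * c ^ 2 * c₂ +
      (35 * α ^ 2 + 4) / 9 * c ^ 4‖ ≤ E + 4 / 3 * t * (1 - t ^ 2) * (1 - ‖x‖ ^ 2) := by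
    rw [e]
    refine (norm_add_le _ _).trans (add_le_add le_rfl ?_)
    rw [norm_mul, norm_mul, norm_real, Real.norm_of_nonneg (by positivity), ← ht]
    calc 4 / 3 * (1 - t ^ 2) * (1 - ‖x‖ ^ 2) * (t * ‖y‖)
        ≤ 4 / 3 * (1 - t ^ 2) * (1 - ‖x‖ ^ 2) * (t * 1) := by gcongr
      _ = _ := by ring
  refine hle.trans ?_
  have hct : ‖c ^ 2‖ = t ^ 2 := by rw [norm_pow]
  rw [hct] at hE
  -- At `t = 0` and `t = 1` the coefficients `A` or `C` vanish, so these cases are separate.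
  rcases ht0.eq_or_lt with h0 | h0
  · rw [← h0] at hE ⊢
    have : E = ‖x‖ ^ 2 := by
      refine (sq_eq_sq₀ (by positivity) (by positivity)).1 ?_
      rw [hE]; ring
    rw [this]
    nlinarith
  rcases hc.eq_or_lt with h1 | h1
  · rw [h1] at hE ⊢
    have : E = (35 * α ^ 2 + 4) / 9 := by
      refine (sq_eq_sq₀ (by positivity) (by positivity)).1 ?_
      rw [hE]; ring
    rw [this]
    linarith
  have hs : 0 < t ^ 2 := by positivity
  have hs1 : 0 < 1 - t ^ 2 := by nlinarith
  refine le_of_critical_bounds (A := (35 * α ^ 2 + 4) / 9 * (t ^ 2) ^ 2)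
    (B := 10 / 3 * α * (1 - t ^ 2) * t ^ 2) (C := (1 - t ^ 2) * (1 + t ^ 2 / 3))
    (q := 75 * α ^ 2 * (1 - t ^ 2) / ((35 * α ^ 2 + 4) * (3 + t ^ 2)))
    (by positivity) (by positivity) (by positivity) (by positivity) ?_ (norm_nonneg x) hx hu ?_
    hE ?_ (third_critical_bound ht0 h1 hD hM1)
    (second_critical_bound hα hα1 hs (by linarith) hD hM)
  · nlinarith [mul_nonneg hs1.le (mul_nonneg (sub_nonneg.2 h1.le) (by linarith : 0 ≤ 3 - t))]
  · field_simp
    ring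
  · refine le_trans (le_of_eq ?_) (hM (t ^ 2) hs.le (by linarith))
    ring

/-! ### Sharp bound and the three regimes of `α`. -/

theorem IsStronglyStarlike.hankel_le {f : ℂ → ℂ} {α M : ℝ} (hα : 0 < α) (hα1 : α ≤ 1)
    (hf : IsStronglyStarlike α f) (hD : (35 * α ^ 2 + 4) / 9 ≤ M)
    (hM : ∀ s : ℝ, 0 ≤ s → s ≤ 1 →
      1 + s * (10 * α - 2) / 3 - s ^ 2 * (35 * α ^ 2 + 30 * α + 7) / 9 ≤ M) :
    ‖logInvCoeff f 1 * logInvCoeff f 3 - logInvCoeff f 2 ^ 2‖ ≤ α ^ 2 / 4 * M := by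
  obtain ⟨g, ω, hg, hg0, hω, hb, hω0, h1, h2⟩ := hf.exists_schwarz hα hα1
  have ha := hω.analyticAt (ball_mem_nhds 0 one_pos)
  have hj := ha.hasJet
  rw [hω0] at hj
  obtain ⟨x, y, hc, hx, hy, e2, e3⟩ := exists_schur_parameters hω hb hω0 hj
  rw [hankel_logInvCoeff hf.toIsNormalizedAnalytic hg hg0 ha h1 h2 hj, norm_mul]
  have : ‖(α : ℂ) ^ 2 / 4‖ = α ^ 2 / 4 := by simp
  rw [this]
  gcongr
  exact norm_hankel_le hα hα1 hD hM hc hx hy e2 e3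

theorem exists_hankel_eq {α s : ℝ} (hα : 0 < α) (hα1 : α ≤ 1) (hs : 0 ≤ s) (hs1 : s ≤ 1) :
    ∃ f : ℂ → ℂ, IsStronglyStarlike α f ∧
      ‖logInvCoeff f 1 * logInvCoeff f 3 - logInvCoeff f 2 ^ 2‖ = α ^ 2 / 4 *
        |1 + s * (10 * α - 2) / 3 - s ^ 2 * (35 * α ^ 2 + 30 * α + 7) / 9| := by
  obtain ⟨ω, hω, hb, hω0, hj⟩ := exists_blaschke (Real.sqrt_nonneg s) (Real.sqrt_le_one.2 hs1)
  obtain ⟨f, g, hf, hg, hg0, h1, h2⟩ := exists_isStronglyStarlike hα hα1 hω hb hω0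
  refine ⟨f, hf, ?_⟩
  have hsq : ((√s : ℝ) : ℂ) ^ 2 = s := by rw [← ofReal_pow, Real.sq_sqrt hs]
  rw [hankel_logInvCoeff hf.toIsNormalizedAnalytic hg hg0
    (hω.analyticAt (ball_mem_nhds 0 one_pos)) h1 h2 hj, norm_mul]
  congr 1
  · simp
  · rw [← norm_neg, ← Real.norm_eq_abs, ← norm_real]
    congr 1
    push_cast
    rw [hsq, show ((√s : ℝ) : ℂ) ^ 4 = s ^ 2 by rw [← hsq]; ring]
    linear_combination (4 / 3 * (1 - s) : ℂ) * hsq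

theorem isGreatest_hankel {α s₀ M V : ℝ} (hα : 0 < α) (hα1 : α ≤ 1)
    (hD : (35 * α ^ 2 + 4) / 9 ≤ M)
    (hM : ∀ s : ℝ, 0 ≤ s → s ≤ 1 →
      1 + s * (10 * α - 2) / 3 - s ^ 2 * (35 * α ^ 2 + 30 * α + 7) / 9 ≤ M)
    (hs : 0 ≤ s₀) (hs1 : s₀ ≤ 1)
    (heq : |1 + s₀ * (10 * α - 2) / 3 - s₀ ^ 2 * (35 * α ^ 2 + 30 * α + 7) / 9| = M)
    (hV : V = α ^ 2 / 4 * M) :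
    IsGreatest {x : ℝ | ∃ f : ℂ → ℂ, IsStronglyStarlike α f ∧
      x = ‖logInvCoeff f 1 * logInvCoeff f 3 - logInvCoeff f 2 ^ 2‖} V := by
  constructor
  · obtain ⟨f, hf, h⟩ := exists_hankel_eq hα hα1 hs hs1
    exact ⟨f, hf, by rw [h, heq, hV]⟩
  · rintro _ ⟨f, hf, rfl⟩
    rw [hV]
    exact hf.hankel_le hα hα1 hD hM

/-- The quartic divided by `x²` is strictly decreasing for `x > 0`; this also gives uniqueness of
the root. -/
theorem quartic_sign {x y : ℝ} (hx : 0 < x) (hxy : x < y)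
    (hy : 0 ≤ 44 + 60 * y + 155 * y ^ 2 - 1050 * y ^ 3 - 1225 * y ^ 4) :
    0 < 44 + 60 * x + 155 * x ^ 2 - 1050 * x ^ 3 - 1225 * x ^ 4 := by
  have hy0 : 0 < y := hx.trans hxy
  have h : 0 < y ^ 2 * (44 + 60 * x + 155 * x ^ 2 - 1050 * x ^ 3 - 1225 * x ^ 4) -
      x ^ 2 * (44 + 60 * y + 155 * y ^ 2 - 1050 * y ^ 3 - 1225 * y ^ 4) := by
    have : y ^ 2 * (44 + 60 * x + 155 * x ^ 2 - 1050 * x ^ 3 - 1225 * x ^ 4) -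
      x ^ 2 * (44 + 60 * y + 155 * y ^ 2 - 1050 * y ^ 3 - 1225 * y ^ 4) =
      (y - x) * (44 * (x + y) + 60 * (x * y) + 1050 * (x * y) ^ 2 +
        1225 * (x * y) ^ 2 * (x + y)) := by ring
    rw [this]
    have := sub_pos.2 hxy
    positivity
  have h2 : 0 < y ^ 2 * (44 + 60 * x + 155 * x ^ 2 - 1050 * x ^ 3 - 1225 * x ^ 4) := by
    have := mul_nonneg (sq_nonneg x) hy
    linarith
  exact pos_of_mul_pos_right h2 (sq_nonneg y)

theorem exists_quartic_root :
    ∃ x : ℝ, 0.390594 < x ∧ x < 0.390596 ∧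
      44 + 60 * x + 155 * x ^ 2 - 1050 * x ^ 3 - 1225 * x ^ 4 = 0 := by
  obtain ⟨x, hx, h⟩ := intermediate_value_Ioo' (a := (0.390594 : ℝ)) (b := 0.390596) (by norm_num)
    (f := fun x => 44 + 60 * x + 155 * x ^ 2 - 1050 * x ^ 3 - 1225 * x ^ 4) (by fun_prop)
    (show (0 : ℝ) ∈ _ from ⟨by norm_num, by norm_num⟩)
  exact ⟨x, hx.1, hx.2, h⟩

/-- Complete the square; the vertex is `s = (15α-3)/(7+30α+35α²)`. -/
theorem quadratic_le_of_fifth_le {α : ℝ} (hα : 0 < α) (s : ℝ) :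
    1 + s * (10 * α - 2) / 3 - s ^ 2 * (35 * α ^ 2 + 30 * α + 7) / 9 ≤
      4 * (2 + 5 * α + 15 * α ^ 2) / (7 + 30 * α + 35 * α ^ 2) := by
  rw [le_div_iff₀ (by positivity)]
  nlinarith [sq_nonneg (s * (35 * α ^ 2 + 30 * α + 7) - (15 * α - 3))]

theorem theorem2 :
    ∃ α' : ℝ,
      (0 < α' ∧ α' < 1 ∧
        44 + 60 * α' + 155 * α' ^ 2 - 1050 * α' ^ 3 - 1225 * α' ^ 4 = 0 ∧
        (∀ x : ℝ, 0 < x → x < 1 →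
          44 + 60 * x + 155 * x ^ 2 - 1050 * x ^ 3 - 1225 * x ^ 4 = 0 → x = α') ∧
        |α' - 0.390595| < 1 / 10 ^ 6) ∧
      ∀ α : ℝ, 0 < α → α ≤ 1 →
        IsGreatest
          {x : ℝ | ∃ f : ℂ → ℂ, IsStronglyStarlike α f ∧
            x = ‖logInvCoeff f 1 * logInvCoeff f 3 - logInvCoeff f 2 ^ 2‖}
          (if α < 1 / 5 then α ^ 2 / 4
            else if α ≤ α' then
              α ^ 2 * (2 + 5 * α + 15 * α ^ 2) / (7 + 30 * α + 35 * α ^ 2)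
            else α ^ 2 / 36 * (4 + 35 * α ^ 2)) := by
  obtain ⟨r, hr1, hr2, hr⟩ := exists_quartic_root
  have hr0 : 0 < r := by linarith
  refine ⟨r, ⟨hr0, by linarith, hr, fun x hx _ h => ?_, ?_⟩, fun α hα hα1 => ?_⟩
  · rcases lt_trichotomy x r with hlt | heq | hlt
    · exact absurd h (quartic_sign hx hlt hr.ge).ne'
    · exact heq
    · exact absurd hr (quartic_sign hr0 hlt h.ge).ne'
  · rw [abs_lt]
    constructor <;> norm_num at * <;> linarith
  have hpos : 0 < 7 + 30 * α + 35 * α ^ 2 := by positivity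
  split_ifs with h1 h2
  · refine isGreatest_hankel (s₀ := 0) (M := 1) hα hα1 (by nlinarith) (fun s hs hs1 => ?_) le_rfl
      zero_le_one (by simp) (by ring)
    have : s * (10 * α - 2) ≤ 0 := mul_nonpos_of_nonneg_of_nonpos hs (by linarith)
    have : 0 ≤ s ^ 2 * (35 * α ^ 2 + 30 * α + 7) := by positivity
    linarith
  · push Not at h1
    refine isGreatest_hankel (s₀ := (15 * α - 3) / (7 + 30 * α + 35 * α ^ 2))
      (M := 4 * (2 + 5 * α + 15 * α ^ 2) / (7 + 30 * α + 35 * α ^ 2)) hα hα1 ?_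
      (fun s _ _ => quadratic_le_of_fifth_le hα s) (div_nonneg (by linarith) hpos.le)
      (div_le_one_of_le₀ (by nlinarith) hpos.le) ?_ (by ring)
    -- Clearing denominators in the comparison of `D` with the maximum of `Q` gives exactly the sign
    -- of the quartic.
    · have hq : 0 ≤ 44 + 60 * α + 155 * α ^ 2 - 1050 * α ^ 3 - 1225 * α ^ 4 := by
        rcases h2.eq_or_lt with rfl | h2
        · exact hr.ge
        · exact (quartic_sign hα h2 hr.ge).le
      rw [div_le_div_iff₀ (by norm_num) hpos]
      nlinarith
    · have : 1 + (15 * α - 3) / (7 + 30 * α + 35 * α ^ 2) * (10 * α - 2) / 3 -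
          ((15 * α - 3) / (7 + 30 * α + 35 * α ^ 2)) ^ 2 * (35 * α ^ 2 + 30 * α + 7) / 9 =
          4 * (2 + 5 * α + 15 * α ^ 2) / (7 + 30 * α + 35 * α ^ 2) := by
        field_simp
        ring
      rw [this]
      exact abs_of_nonneg (by positivity)
  · push Not at h1 h2
    have hq : 44 + 60 * α + 155 * α ^ 2 - 1050 * α ^ 3 - 1225 * α ^ 4 < 0 := by
      by_contra! h
      exact (quartic_sign hr0 h2 h).ne' hr
    refine isGreatest_hankel (s₀ := 1) (M := (35 * α ^ 2 + 4) / 9) hα hα1 le_rfl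
      (fun s _ _ => (quadratic_le_of_fifth_le hα s).trans ?_) zero_le_one le_rfl ?_ (by ring)
    · rw [div_le_div_iff₀ hpos (by norm_num)]
      nlinarith
    · rw [abs_of_nonpos] <;> nlinarith
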